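/- Notation. Let $s\mathcal B_n$ be the set of symmetric Boolean functions $f:\{0,1\}^n\to\{0,1\}$, i.e. $f(a)=\mathrm{Spec}\,f(|a|)$ for a string $\mathrm{Spec}\,f:\{0,\dots,n\}\to\{0,1\}$, where $|a|$ is the Hamming weight. The period $\mathrm{per}(f)$ is the least integer $b\ge 1$ with $\mathrm{Spec}\,f(i)=\mathrm{Spec}\,f(i+b)$ for all integers $0\le i\le n-b$, and $B(f)$ is the least integer $k\ge 0$ such that $\mathrm{Spec}\,f$ is constant on the integers in $[k,n-k]$. A standard decomposition of $f\in s\mathcal B_n$ is a pair $(g,h)$ where $g$ has the smallest period among all functions in $s\mathcal B_n$ whose spectrum agrees with $\mathrm{Spec}\,f$ on the integers in $[\lceil n/3\rceil,\lfloor 2n/3\rfloor]$, and $h=f\oplus g$. For a field $\mathbb F$ and $\varepsilon>0$, $\mathrm{pdeg}^{\mathbb F}_\varepsilon(f)$ is the least $d$ for which there is a finitely supported random polynomial $\mathbf P\in\mathbb F[x_1,\dots,x_n]$, all of whose values have degree at most $d$, such that $\Pr[\mathbf P(a)\ne f(a)]\le\varepsilon$ for every $a\in\{0,1\}^n$. "A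 power of $p$" means $p^j$ with $j\ge 1$ (so for $p=0$ no period is a power of $p$). Theorem. Let $p$ be $0$ or a prime. There are a constant $c>0$ and an integer $k\ge 0$, depending only on $p$, such that the following holds for every field $\mathbb F$ of characteristic $p$, every $n$, every $f\in s\mathcal B_n$, every standard decomposition $(g,h)$ of $f$ and every $\varepsilon\in[2^{-n},1/3]$ (such $\varepsilon$ exist only if $n\ge2$). Write $X=\widetilde\Omega(Y)$ for $X\ge c\,Y/(\log n)^k$. 1. $\mathrm{pdeg}^{\mathbb F}_\varepsilon(g)=\widetilde\Omega\big(\sqrt{n\log(1/\varepsilon)}\big)$ if $\mathrm{per}(g)>1$ and $\mathrm{per}(g)$ is not a power of $p$, and $\mathrm{pdeg}^{\mathbb F}_\varepsilon(g)=\widetilde\Omega\big(\min\{\sqrt{n\log(1/\varepsilon)},\mathrm{per}(g)\}\big)$ if $\mathrm{per}(g)$ is a power of $p$. 2. $\mathrm{pdeg}^{\mathbb F}_\varepsilon(h)=\widetilde\Omega\big(\sqrt{B(h)\log(1/\varepsilon)}+\log(1/\varepsilon)\big)$ if $B(h)\ge1$. 3. (a) If $\mathrm{per}(g)>1$ and $\mathrm{per}(g)$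 is not a power of $p$, then $\mathrm{pdeg}^{\mathbb F}_\varepsilon(f)=\widetilde\Omega\big(\sqrt{n\log(1/\varepsilon)}\big)$. (b) If $\mathrm{per}(g)$ is a power of $p$ and $B(h)=0$, then $\mathrm{pdeg}^{\mathbb F}_\varepsilon(f)=\widetilde\Omega\big(\min\{\sqrt{n\log(1/\varepsilon)},\mathrm{per}(g)\}\big)$. (c) In all other cases, provided $f$ is not constant, $\mathrm{pdeg}^{\mathbb F}_\varepsilon(f)=\widetilde\Omega\big(\min\{\sqrt{n\log(1/\varepsilon)},\ \mathrm{per}(g)+\sqrt{B(h)\log(1/\varepsilon)}+\log(1/\varepsilon)\}\big)$. -/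

import Mathlib

/-- Boolean functions on `n` variables. -/
abbrev BoolFun (n : ℕ) := (Fin n → Bool) → Bool

namespace BoolFun

/-- The Hamming weight of a point of the cube. -/
def weight {n : ℕ} (a : Fin n → Bool) : ℕ := (Finset.univ.filter fun i => a i = true).card

/-- `f` is symmetric: its value depends only on the Hamming weight of the input. -/
def IsSymmetric {n : ℕ} (f : BoolFun n) : Prop :=
  ∀ a b : Fin n → Bool, weight a = weight b → f a = f b

/-- The spectrum of `f`: its value on the point `1^i 0^(n-i)`. For symmetric `f` and `i ≤ n` this
is the common value of `f` on the points of weight `i`; it is only used for `i ≤ n`. -/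
def spec {n : ℕ} (f : BoolFun n) (i : ℕ) : Bool := f fun j => decide (j.val < i)

theorem eq_spec_weight {n : ℕ} {f : BoolFun n} (hf : f.IsSymmetric) (a : Fin n → Bool) :
    f a = f.spec (weight a) := by
  refine hf _ _ ?_
  have hle : weight a ≤ n := by
    simpa [weight] using Finset.card_le_univ (Finset.univ.filter fun i => a i = true)
  generalize weight a = w at hle
  change w = (Finset.univ.filter fun j : Fin n => decide (j.val < w) = true).card
  simp only [decide_eq_true_eq]
  rw [Fin.card_filter_val_lt]
  omega

/-- The period: the least positive `b` with `Spec f(i) = Spec f(i+b)` whenever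
`0 ≤ i` and `i + b ≤ n`. -/
noncomputable def per {n : ℕ} (f : BoolFun n) : ℕ :=
  sInf {b : ℕ | 0 < b ∧ ∀ i : ℕ, i + b ≤ n → f.spec i = f.spec (i + b)}

/-- `f` is `k`-bounded: its spectrum is constant on the integer interval `[k, n-k]`. -/
def IsBounded {n : ℕ} (f : BoolFun n) (k : ℕ) : Prop :=
  ∃ v : Bool, ∀ i : ℕ, k ≤ i → i + k ≤ n → f.spec i = v

/-- `B(f)`: the least `k` such that `f` is `k`-bounded. -/
noncomputable def bd {n : ℕ} (f : BoolFun n) : ℕ := sInf {k : ℕ | f.IsBounded k}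

/-- The spectra of `f` and `g` agree on the integer interval `[⌈n/3⌉, ⌊2n/3⌋]`. -/
def AgreeMiddle {n : ℕ} (f g : BoolFun n) : Prop :=
  ∀ i : ℕ, n ≤ 3 * i → 3 * i ≤ 2 * n → g.spec i = f.spec i

/-- `(g, h)` is a standard decomposition of the symmetric Boolean function `f`: among all symmetric
functions agreeing with `f` on the middle weights, `g` has the least period, and `h = f ⊕ g`. -/
structure IsStandardDecomposition {n : ℕ} (f g h : BoolFun n) : Prop where
  symm : f.IsSymmetric
  symm_periodic : g.IsSymmetric
  agree : AgreeMiddle f g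
  per_le : ∀ f' : BoolFun n, f'.IsSymmetric → AgreeMiddle f f' → g.per ≤ f'.per
  bounded_eq : ∀ a, h a = xor (f a) (g a)

/-- `f` is a constant function. -/
def IsConstant {n : ℕ} (f : BoolFun n) : Prop := ∀ a b, f a = f b

end BoolFun

/-- A bit as an element of `F`. -/
def bitVal (F : Type*) [Field F] (x : Bool) : F := if x then 1 else 0

/-- `P`, a probability distribution with finite support on `F[x₁,…,xₙ]`, is an `ε`-error
probabilistic polynomial for `f`: at each point of the cube, the probability that the random
polynomial disagrees with `f` is at most `ε`. -/
def IsProbPoly {F : Type*} [Field F] {n : ℕ} (P : PMF (MvPolynomial (Fin n) F)) (ε : ℝ)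
    (f : BoolFun n) : Prop :=
  P.support.Finite ∧ ∀ a : Fin n → Bool,
    P.toOuterMeasure {Q | MvPolynomial.eval (fun i => bitVal F (a i)) Q ≠ bitVal F (f a)}
      ≤ ENNReal.ofReal ε

/-- The `ε`-error probabilistic degree of `f` over `F`. -/
noncomputable def pdeg (F : Type*) [Field F] {n : ℕ} (ε : ℝ) (f : BoolFun n) : ℕ :=
  sInf {d : ℕ | ∃ P : PMF (MvPolynomial (Fin n) F),
    IsProbPoly P ε f ∧ ∀ Q ∈ P.support, Q.totalDegree ≤ d}

/-- `b` is a power of `p` (with positive exponent). -/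
def IsPowerOf (p b : ℕ) : Prop := ∃ j : ℕ, 1 ≤ j ∧ b = p ^ j

/-!
The proof works over an algebraic closure `K` of `F`, with functions on the cube instead of
polynomials, and with `s i`, the bit `Spec f(i)` read in `K`.

*Source of hardness.* If `z ≠ 0, 1`, the function `z ^ |a|` on `2w` variables is hard: by
Smolensky's dimension argument (`card_filter_card_le_card_ne`), a polynomial of degree `D` errs on
at least as many points as there are sets of more than `w + D` elements. Setting variables of `f` to
constants shifts its spectrum, so every linear combination of shifts of `s` is computed by a
polynomial of the degree of one for `f`. The number of terms multiplies the error, but error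
reduction (`ProbApprox.amplify`) makes the error smaller by any power of `n` for a factor
`O(log n)` in the degree. So it is enough to find a geometric sequence `z ^ i` among the linear
combinations of shifts of `s`, at least for the weights `i` near `w` that carry all but an
`ε`-fraction of the cube (`ProbApprox.smolensky`).

*Finding it.* Either the windows of length `r` of `s` span `Kʳ`, and then every sequence of length
`r` is such a combination (`ProbApprox.le_or_le_of_windowsSpan`), or a linear functional vanishes on
all windows, so that `s` satisfies a linear recurrence of order less than `r`. If its characteristic
polynomial has a root `z ≠ 0, 1`, a polynomial in the shift turns `s` into `z ^ i`; otherwise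
`(X - 1) ^ k` annihilates `s` on the middle third (`Kills.eigen_or_unipotent`). In characteristic
`p` the latter makes the middle third periodic with period a power of `p` that is `O(k + 1)`; in
characteristic `0` one can reduce modulo `2` and `3`, so by the theorem of Fine and Wilf the middle
third is constant. Comparing with `per(g)`, which is the least period of the middle third
(`per_le_of_period`), gives the bounds of the periodic part, for `g` and `f` alike.

*The bounded part.* The windows of length `B(h)` of `Spec h` span, since a shorter recurrence would
extend the zeros in the middle too far; this gives `√(B(h) log(1/ε))` if `B(h) ≥ log(1/ε)`. The term
`log(1/ε)` comes from a subcube on which `h` is `1` at exactly one point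
(`ProbApprox.one_le_of_unique`). When `per(g)` is `1` or a power of `p`, Newton's difference formula
represents `g` by a polynomial of degree at most `per(g)`, so `h = f ⊕ g` has degree at most that
of `f` plus `per(g)`, and the bound for `h` becomes one for `f` (`le_pdeg_of_per_le`).
-/

namespace ProbDegree

open Finset Polynomial

/-! ### Functions of low degree on the Boolean cube -/

/-- The multilinear monomial `∏ i ∈ I, xᵢ`, as a function on the Boolean cube. -/
def monom (K : Type*) [Field K] {n : ℕ} (I : Finset (Fin n)) (a : Fin n → Bool) : K :=
  ∏ i ∈ I, bitVal K (a i)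

/-- The functions on the cube `{0,1}ⁿ` that are represented by a polynomial of degree at most `d`,
encoded as the span of the multilinear monomials of degree at most `d`. -/
def lowDeg (K : Type*) [Field K] (n d : ℕ) : Submodule K ((Fin n → Bool) → K) :=
  Submodule.span K (monom K '' {I : Finset (Fin n) | I.card ≤ d})

section LowDegree

variable {K : Type*} [Field K] {n m d e : ℕ}

lemma monom_apply (I : Finset (Fin n)) (a : Fin n → Bool) :
    monom K I a = if ∀ i ∈ I, a i = true then 1 else 0 := by
  unfold monom bitVal
  split_ifs with h
  · exact prod_eq_one fun i hi => by simp [h i hi]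
  · push Not at h
    obtain ⟨i, hi, hai⟩ := h
    exact prod_eq_zero hi (by simp [hai])

lemma monom_mul (I J : Finset (Fin n)) : monom K I * monom K J = monom K (I ∪ J) := by
  funext a
  simp only [Pi.mul_apply, monom_apply]
  split_ifs <;> grind

lemma monom_mem {I : Finset (Fin n)} (h : I.card ≤ d) : monom K I ∈ lowDeg K n d :=
  Submodule.subset_span ⟨I, h, rfl⟩

lemma lowDeg_mono (h : d ≤ e) : lowDeg K n d ≤ lowDeg K n e :=
  Submodule.span_mono (Set.image_mono fun _ hI => le_trans hI h)

lemma mul_mem_lowDeg {φ ψ : (Fin n → Bool) → K} (hφ : φ ∈ lowDeg K n d) (hψ : ψ ∈ lowDeg K n e) :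
    φ * ψ ∈ lowDeg K n (d + e) := by
  have h := Submodule.mul_mem_mul hφ hψ
  unfold lowDeg at h
  rw [Submodule.span_mul_span] at h
  refine Submodule.span_mono ?_ h
  rintro _ ⟨_, ⟨I, hI, rfl⟩, _, ⟨J, hJ, rfl⟩, rfl⟩
  exact ⟨I ∪ J, (card_union_le I J).trans (add_le_add hI hJ), (monom_mul I J).symm⟩

lemma one_mem_lowDeg : (1 : (Fin n → Bool) → K) ∈ lowDeg K n d := by
  have : (1 : (Fin n → Bool) → K) = monom K ∅ := by funext a; simp [monom]
  rw [this]; exact monom_mem (by simp)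

lemma const_mem_lowDeg (c : K) : (fun _ => c : (Fin n → Bool) → K) ∈ lowDeg K n d := by
  have := (lowDeg K n d).smul_mem c one_mem_lowDeg
  convert this using 1
  funext a; simp

lemma coord_mem_lowDeg (i : Fin n) : (fun a => bitVal K (a i)) ∈ lowDeg K n 1 := by
  have : (fun a => bitVal K (a i)) = monom K {i} := by funext a; simp [monom]
  rw [this]; exact monom_mem (by simp)

lemma affine_mem_lowDeg (b c : K) (i : Fin n) :
    (fun a => b + c * bitVal K (a i)) ∈ lowDeg K n 1 :=
  (lowDeg K n 1).add_mem (const_mem_lowDeg b) ((lowDeg K n 1).smul_mem c (coord_mem_lowDeg i))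

lemma prod_mem_lowDeg {ι : Type*} (s : Finset ι) (φ : ι → (Fin n → Bool) → K) (k : ι → ℕ)
    (h : ∀ i ∈ s, φ i ∈ lowDeg K n (k i)) : (∏ i ∈ s, φ i) ∈ lowDeg K n (∑ i ∈ s, k i) := by
  classical
  induction s using Finset.induction_on with
  | empty => simpa using one_mem_lowDeg
  | insert i s hi ih =>
    rw [prod_insert hi, sum_insert hi]
    exact mul_mem_lowDeg (h i (mem_insert_self i s))
      (ih fun j hj => h j (mem_insert_of_mem hj))

lemma prod_affine_mem_lowDeg {ι : Type*} (s : Finset ι) (φ : ι → (Fin n → Bool) → K)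
    (h : ∀ i ∈ s, φ i ∈ lowDeg K n 1) : (fun a => ∏ i ∈ s, φ i a) ∈ lowDeg K n s.card := by
  have := prod_mem_lowDeg s φ (fun _ => 1) h
  rw [sum_const, smul_eq_mul, mul_one] at this
  convert this using 1
  funext a; simp

lemma eval_mem_lowDeg {Q : MvPolynomial (Fin n) K} (hQ : Q.totalDegree ≤ d) :
    (fun a => MvPolynomial.eval (fun i => bitVal K (a i)) Q) ∈ lowDeg K n d := by
  have key : (fun a => MvPolynomial.eval (fun i => bitVal K (a i)) Q)
      = ∑ v ∈ Q.support, Q.coeff v • monom K v.support := by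
    funext a
    rw [MvPolynomial.eval_eq, Finset.sum_apply]
    refine sum_congr rfl fun v _ => ?_
    simp only [Pi.smul_apply, smul_eq_mul, monom]
    congr 1
    refine prod_congr rfl fun i hi => ?_
    have hi : v i ≠ 0 := by simpa using hi
    cases a i <;> simp [bitVal, hi]
  rw [key]
  refine Submodule.sum_mem _ fun v hv => Submodule.smul_mem _ _ (monom_mem ?_)
  refine le_trans ?_ ((MvPolynomial.le_totalDegree hv).trans hQ)
  rw [card_eq_sum_ones, Finsupp.sum]
  exact sum_le_sum fun i hi => Nat.one_le_iff_ne_zero.mpr (by simpa using hi)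

lemma algebraMap_comp_mem_lowDeg {L : Type*} [Field L] [Algebra K L] {φ : (Fin n → Bool) → K}
    (h : φ ∈ lowDeg K n d) : (fun a => algebraMap K L (φ a)) ∈ lowDeg L n d := by
  induction h using Submodule.span_induction with
  | mem x hx =>
    obtain ⟨I, hI, rfl⟩ := hx
    have : (fun a => algebraMap K L (monom K I a)) = monom L I := by
      funext a; simp only [monom_apply]; split_ifs <;> simp
    rw [this]; exact monom_mem hI
  | zero => simp only [Pi.zero_apply, map_zero]; exact const_mem_lowDeg 0
  | add x y _ _ hx hy => simp only [Pi.add_apply, map_add]; exact Submodule.add_mem _ hx hy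
  | smul c x _ hx =>
    simp only [Pi.smul_apply, smul_eq_mul, map_mul]
    exact Submodule.smul_mem _ (algebraMap K L c) hx

/-- The point of the `n`-cube that continues a point of the `m`-cube by `j` ones, and then by
zeros. -/
def extend (n j : ℕ) {m : ℕ} (a : Fin m → Bool) : Fin n → Bool :=
  fun i => if h : i.1 < m then a ⟨i, h⟩ else decide (i.1 < m + j)

lemma weight_extend {j : ℕ} (h : j + m ≤ n) (a : Fin m → Bool) :
    BoolFun.weight (extend n j a) = BoolFun.weight a + j := by
  obtain ⟨k, rfl⟩ := Nat.exists_eq_add_of_le h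
  have e : ∀ {N : ℕ} (b : Fin N → Bool), BoolFun.weight b = ∑ i, if b i = true then 1 else 0 := by
    intro N b; rw [BoolFun.weight, card_filter]
  rw [e, e]
  have hN : j + m + k = m + (j + k) := by ring
  have h1 : (∑ i : Fin (j + m + k), if extend (j + m + k) j a i = true then 1 else 0)
      = ∑ i : Fin (m + (j + k)), if extend (m + (j + k)) j a i = true then 1 else 0 := by
    rw [hN]
  rw [h1, Fin.sum_univ_add, Fin.sum_univ_add]
  simp [extend]

lemma comp_extend_mem_lowDeg (j : ℕ) {φ : (Fin n → Bool) → K} (h : φ ∈ lowDeg K n d) :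
    (fun a : Fin m → Bool => φ (extend n j a)) ∈ lowDeg K m d := by
  induction h using Submodule.span_induction with
  | mem x hx =>
    obtain ⟨I, hI, rfl⟩ := hx
    refine lowDeg_mono hI ?_
    refine prod_affine_mem_lowDeg I (fun i a => bitVal K (extend n j a i)) fun i _ => ?_
    by_cases h : i.1 < m
    · simpa [extend, h] using coord_mem_lowDeg (K := K) (⟨i, h⟩ : Fin m)
    · simpa [extend, h] using const_mem_lowDeg (d := 1) (bitVal K (decide (i.1 < m + j)))
  | zero => exact const_mem_lowDeg 0
  | add x y _ _ hx hy => exact Submodule.add_mem _ hx hy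
  | smul c x _ hx => exact Submodule.smul_mem _ c hx

lemma sum_prod_bool (h : Fin n → Bool → K) :
    ∑ a : Fin n → Bool, ∏ i, h i (a i) = ∏ i, (h i true + h i false) := by
  have := Finset.prod_univ_sum (fun _ : Fin n => (univ : Finset Bool)) h
  rw [Fintype.piFinset_univ] at this
  rw [← this]
  simp

lemma prod_pow_weight (z : K) (a : Fin n → Bool) :
    ∏ i, (if a i = true then z else 1) = z ^ BoolFun.weight a := by
  rw [BoolFun.weight, prod_ite]; simp

/-- The top multilinear coefficient of a polynomial is the alternating sum of its values. -/
lemma alternating_sum_eq_zero {φ : (Fin n → Bool) → K} (h : φ ∈ lowDeg K n d) (hd : d < n) :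
    ∑ a, (-1) ^ BoolFun.weight a * φ a = 0 := by
  induction h using Submodule.span_induction with
  | mem x hx =>
    obtain ⟨I, hI, rfl⟩ := hx
    obtain ⟨i, hi⟩ : ∃ i, i ∉ I := by
      by_contra! hc
      have : I = univ := eq_univ_of_forall hc
      subst this
      simp at hI; omega
    let u : Fin n → Bool → K := fun i b =>
      (if b = true then -1 else 1) * (if i ∈ I then bitVal K b else 1)
    have hterm : ∀ a : Fin n → Bool, (-1 : K) ^ BoolFun.weight a * monom K I a
        = ∏ i, u i (a i) := by
      intro a
      rw [prod_mul_distrib, prod_pow_weight, monom]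
      simp
    rw [sum_congr rfl fun a _ => hterm a, sum_prod_bool u]
    exact prod_eq_zero (mem_univ i) (by simp [u, hi])
  | zero => simp
  | add x y _ _ hx hy => simp only [Pi.add_apply, mul_add, sum_add_distrib, hx, hy, add_zero]
  | smul c x _ hx =>
    simp only [Pi.smul_apply, smul_eq_mul]
    rw [← mul_zero c, ← hx, mul_sum]
    exact sum_congr rfl fun a _ => by ring

/-- Smolensky's dimension argument: if a polynomial of degree `D` on `2w` variables computes
`z ^ |a|` off a set `E`, then off `E` every function has degree at most `w + D`, because a product
of more than `w` of the functions `z ^ aᵢ` is `z ^ |a|` times a product of at most `w` of their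
inverses. -/
lemma card_filter_card_le_card_ne {w D : ℕ} {z : K} (hz0 : z ≠ 0) (hz1 : z ≠ 1)
    {φ : (Fin (2 * w) → Bool) → K} (hφ : φ ∈ lowDeg K (2 * w) D) [DecidableEq K] :
    #{I : Finset (Fin (2 * w)) | w + D < I.card} ≤ #{a | φ a ≠ z ^ BoolFun.weight a} := by
  classical
  set S : Finset (Fin (2 * w) → Bool) := {a | φ a = z ^ BoolFun.weight a} with hS
  let ρ : ((Fin (2 * w) → Bool) → K) →ₗ[K] (S → K) := LinearMap.funLeft K K Subtype.val
  let y : Fin (2 * w) → (Fin (2 * w) → Bool) → K := fun i a => if a i = true then z else 1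
  have hy : ∀ i, y i ∈ lowDeg K (2 * w) 1 := by
    intro i
    convert affine_mem_lowDeg (1 : K) (z - 1) i using 1
    funext a; cases h : a i <;> simp [y, h, bitVal]
  have hyinv : ∀ i, (fun a => (y i a)⁻¹) ∈ lowDeg K (2 * w) 1 := by
    intro i
    convert affine_mem_lowDeg (1 : K) (z⁻¹ - 1) i using 1
    funext a; cases h : a i <;> simp [y, h, bitVal]
  have hyne : ∀ i a, y i a ≠ 0 := by
    intro i a; cases h : a i <;> simp [y, h, hz0]
  have hY : ∀ I : Finset (Fin (2 * w)),
      ρ (fun a => ∏ i ∈ I, y i a) ∈ (lowDeg K (2 * w) (w + D)).map ρ := by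
    intro I
    by_cases hI : I.card ≤ w
    · exact Submodule.mem_map_of_mem
        (lowDeg_mono (by omega) (prod_affine_mem_lowDeg I y fun i _ => hy i))
    · refine ⟨φ * fun a => ∏ i ∈ Iᶜ, (y i a)⁻¹, ?_, ?_⟩
      · refine lowDeg_mono ?_ (mul_mem_lowDeg hφ (prod_affine_mem_lowDeg Iᶜ _ fun i _ => hyinv i))
        rw [card_compl, Fintype.card_fin]; omega
      · funext a
        have ha : φ a.1 = z ^ BoolFun.weight a.1 := (mem_filter.mp a.2).2
        simp only [ρ, LinearMap.funLeft_apply, Pi.mul_apply, ha]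
        rw [← prod_pow_weight, ← prod_mul_prod_compl I, mul_assoc, ← prod_mul_distrib,
          prod_eq_one (s := Iᶜ), mul_one]
        intro i _
        exact mul_inv_cancel₀ (hyne i a.1)
  have hsingle : ∀ b : Fin (2 * w) → Bool,
      ρ (Pi.single b 1) ∈ (lowDeg K (2 * w) (w + D)).map ρ := by
    intro b
    have hz : z - 1 ≠ 0 := sub_ne_zero.mpr hz1
    let u : Fin (2 * w) → K := fun i => if b i = true then 1 / (z - 1) else -1 / (z - 1)
    let v : Fin (2 * w) → K := fun i => if b i = true then -1 / (z - 1) else z / (z - 1)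
    have : (Pi.single b 1 : (Fin (2 * w) → Bool) → K)
        = ∑ I ∈ univ.powerset,
          ((∏ i ∈ I, u i) * ∏ i ∈ univ \ I, v i) • fun a => ∏ i ∈ I, y i a := by
      funext a
      have h1 : (Pi.single b 1 : (Fin (2 * w) → Bool) → K) a = ∏ i, (u i * y i a + v i) := by
        by_cases hab : a = b
        · subst hab
          rw [Pi.single_eq_same]
          refine (prod_eq_one fun i _ => ?_).symm
          cases h : a i <;> simp [u, v, y, h] <;> field_simp <;> ring
        · rw [Pi.single_eq_of_ne hab]
          obtain ⟨i, hi⟩ := Function.ne_iff.mp hab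
          refine (prod_eq_zero (mem_univ i) ?_).symm
          cases h : a i <;> cases h' : b i <;> simp_all [u, v, y] <;> field_simp <;> ring
      rw [h1, prod_add, Finset.sum_apply]
      refine sum_congr rfl fun I _ => ?_
      simp only [Pi.smul_apply, smul_eq_mul, prod_mul_distrib]
      ring
    rw [this, map_sum]
    exact Submodule.sum_mem _ fun I _ => by rw [map_smul]; exact Submodule.smul_mem _ _ (hY I)
  have htop : (lowDeg K (2 * w) (w + D)).map ρ = ⊤ := by
    rw [eq_top_iff]
    rintro ψ -
    have hψ : ψ = ρ (∑ b : Fin (2 * w) → Bool,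
        (if h : b ∈ S then ψ ⟨b, h⟩ else 0) • Pi.single b (1 : K)) := by
      funext a
      simp only [ρ, LinearMap.funLeft_apply, Finset.sum_apply, Pi.smul_apply, smul_eq_mul]
      rw [sum_eq_single a.1]
      · simp
      · intro b _ hb; rw [Pi.single_eq_of_ne (Ne.symm hb), mul_zero]
      · simp
    rw [hψ, map_sum]
    exact Submodule.sum_mem _ fun b _ => by rw [map_smul]; exact Submodule.smul_mem _ _ (hsingle b)
  have hdim : S.card ≤ #{I : Finset (Fin (2 * w)) | I.card ≤ w + D} := by
    have h1 : Module.finrank K ((lowDeg K (2 * w) (w + D)).map ρ) = S.card := by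
      rw [htop, finrank_top, Module.finrank_fintype_fun_eq_card, Fintype.card_coe]
    rw [← h1]
    refine (Submodule.finrank_map_le ρ _).trans ?_
    have h2 : monom K '' {I : Finset (Fin (2 * w)) | I.card ≤ w + D}
        = ((({I : Finset (Fin (2 * w)) | I.card ≤ w + D} : Finset _).image (monom K) :
            Finset ((Fin (2 * w) → Bool) → K)) : Set _) := by
      simp
    unfold lowDeg
    rw [h2]
    exact (finrank_span_finset_le_card _).trans card_image_le
  have hA := card_filter_add_card_filter_not (s := (univ : Finset (Finset (Fin (2 * w)))))
    (fun I => I.card ≤ w + D)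
  have hB := card_filter_add_card_filter_not (s := (univ : Finset (Fin (2 * w) → Bool)))
    (fun a => φ a = z ^ BoolFun.weight a)
  have hC : #(univ : Finset (Finset (Fin (2 * w)))) = #(univ : Finset (Fin (2 * w) → Bool)) := by
    simp
  simp only [not_le] at hA
  rw [← hS] at hB
  change _ ≤ #{a | ¬ φ a = z ^ BoolFun.weight a}
  omega

end LowDegree

/-! ### Probabilistic polynomials and error reduction -/

open Classical in
/-- `f` has an `ε`-error probabilistic polynomial of degree at most `d` over `K`: a finite family
of functions of degree at most `d` with probability weights `w`, such that at each point of the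
cube the family disagrees with `f` with probability at most `ε`. -/
def ProbApprox (K : Type*) [Field K] {n : ℕ} (ε : ℝ) (d : ℕ) (f : BoolFun n) : Prop :=
  ∃ (Ω : Type) (_ : Fintype Ω) (w : Ω → ℝ) (P : Ω → (Fin n → Bool) → K),
    (∀ ω, 0 ≤ w ω) ∧ ∑ ω, w ω = 1 ∧ (∀ ω, P ω ∈ lowDeg K n d) ∧
      ∀ a, ∑ ω, (if P ω a = bitVal K (f a) then 0 else w ω) ≤ ε

section ProbabilisticPolynomials

variable {K : Type*} [Field K] {n d e : ℕ} {ε : ℝ} {f : BoolFun n}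

lemma ProbApprox.baseChange (L : Type*) [Field L] [Algebra K L] (h : ProbApprox K ε d f) :
    ProbApprox L ε d f := by
  classical
  obtain ⟨Ω, _, w, P, h0, h1, h2, h3⟩ := h
  refine ⟨Ω, _, w, fun ω a => algebraMap K L (P ω a), h0, h1,
    fun ω => algebraMap_comp_mem_lowDeg (h2 ω), fun a => ?_⟩
  have hb : ∀ b : Bool, bitVal L b = algebraMap K L (bitVal K b) := by
    intro b; cases b <;> simp [bitVal]
  have hi : ∀ ω, algebraMap K L (P ω a) = bitVal L (f a) ↔ P ω a = bitVal K (f a) := by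
    intro ω; rw [hb, (algebraMap K L).injective.eq_iff]
  refine le_trans (le_of_eq (sum_congr rfl fun ω _ => ?_)) (h3 a)
  exact if_congr (hi ω) rfl rfl

lemma exists_mvPolynomial_eval_eq (f : BoolFun n) : ∃ Q : MvPolynomial (Fin n) K,
    ∀ a, MvPolynomial.eval (fun i => bitVal K (a i)) Q = bitVal K (f a) := by
  refine ⟨∑ b, MvPolynomial.C (bitVal K (f b)) *
    ∏ i, (if b i = true then MvPolynomial.X i else 1 - MvPolynomial.X i), fun a => ?_⟩
  rw [map_sum, sum_eq_single a]
  · rw [map_mul, MvPolynomial.eval_C, map_prod, prod_eq_one, mul_one]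
    intro i _
    cases h : a i <;> simp [bitVal, h]
  · intro b _ hb
    rw [map_mul, map_prod]
    obtain ⟨i, hi⟩ := Function.ne_iff.mp hb
    rw [prod_eq_zero (mem_univ i), mul_zero]
    cases h : a i <;> cases h' : b i <;> simp_all [bitVal]
  · simp

/-- The degree `pdeg K ε f` is attained: exact representations exist, so the infimum is not over
the empty set. -/
lemma probApprox_pdeg (hε : 0 ≤ ε) (f : BoolFun n) : ProbApprox K ε (pdeg K ε f) f := by
  classical
  have hne : {d : ℕ | ∃ P : PMF (MvPolynomial (Fin n) K),
      IsProbPoly P ε f ∧ ∀ Q ∈ P.support, Q.totalDegree ≤ d}.Nonempty := by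
    obtain ⟨Q, hQ⟩ := exists_mvPolynomial_eval_eq (K := K) f
    refine ⟨Q.totalDegree, PMF.pure Q, ⟨by simp, fun a => ?_⟩, by simp⟩
    rw [PMF.toOuterMeasure_pure_apply, if_neg (by simp [hQ a])]
    exact zero_le
  obtain ⟨P, ⟨hfin, herr⟩, hdeg⟩ := Nat.sInf_mem hne
  set S := hfin.toFinset with hS
  have hmem : ∀ Q, Q ∉ S → P Q = 0 := by
    intro Q hQ
    rw [hS, Set.Finite.mem_toFinset] at hQ
    exact (PMF.apply_eq_zero_iff P Q).mpr hQ
  have hsum : ∀ u : MvPolynomial (Fin n) K → ℝ,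
      ∑ ω : Fin S.card, u (S.equivFin.symm ω).1 = ∑ Q ∈ S, u Q := by
    intro u
    rw [Equiv.sum_comp S.equivFin.symm (fun Q : S => u Q.1), sum_coe_sort S u]
  -- the support is reindexed by `Fin S.card`, which lives in `Type`
  refine ⟨Fin S.card, inferInstance, fun ω => (P (S.equivFin.symm ω).1).toReal,
    fun ω a => MvPolynomial.eval (fun i => bitVal K (a i)) (S.equivFin.symm ω).1,
    fun ω => ENNReal.toReal_nonneg, ?_, fun ω => ?_, fun a => ?_⟩
  · rw [hsum fun Q => (P Q).toReal, ← ENNReal.toReal_sum fun Q _ => P.apply_ne_top Q,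
      ← tsum_eq_sum (L := SummationFilter.unconditional _) (fun Q hQ => hmem Q hQ), P.tsum_coe,
      ENNReal.toReal_one]
  · exact eval_mem_lowDeg (hdeg _ (hfin.mem_toFinset.mp (S.equivFin.symm ω).2))
  · rw [hsum fun Q => if MvPolynomial.eval (fun i => bitVal K (a i)) Q = bitVal K (f a) then 0
      else (P Q).toReal]
    have h1 := herr a
    rw [PMF.toOuterMeasure_apply, tsum_eq_sum (s := S)
      (fun Q hQ => by rw [Set.indicator_apply, hmem Q hQ, ite_self])] at h1
    have h2 := ENNReal.toReal_mono ENNReal.ofReal_ne_top h1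
    rw [ENNReal.toReal_ofReal hε, ENNReal.toReal_sum] at h2
    · refine le_trans (le_of_eq (sum_congr rfl fun Q _ => ?_)) h2
      by_cases hQ : MvPolynomial.eval (fun i => bitVal K (a i)) Q = bitVal K (f a) <;>
        simp [hQ]
    · intro Q _
      rw [Set.indicator_apply]
      split_ifs
      · exact P.apply_ne_top Q
      · simp

/-- Degree `0` forces `f` to be constant: the error probabilities at two points with different
values add up to at least `1`. -/
lemma ProbApprox.isConstant (h : ProbApprox K ε 0 f) (hε : ε ≤ 1 / 3) : f.IsConstant := by
  classical
  obtain ⟨Ω, _, w, P, h0, h1, h2, h3⟩ := h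
  intro a b
  by_contra hab
  have hconst : ∀ ω, P ω a = P ω b := by
    intro ω
    have hω := h2 ω
    generalize P ω = φ at hω
    induction hω using Submodule.span_induction with
    | mem x hx =>
      obtain ⟨I, hI, rfl⟩ := hx
      have : I = ∅ := by simpa using hI
      simp [this, monom]
    | zero => rfl
    | add x y _ _ hx hy => simp [hx, hy]
    | smul c x _ hx => simp [hx]
  have hle : ∑ ω, w ω ≤ ∑ ω, ((if P ω a = bitVal K (f a) then 0 else w ω)
      + (if P ω b = bitVal K (f b) then 0 else w ω)) := by
    refine sum_le_sum fun ω _ => ?_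
    rw [hconst ω]
    have hne : bitVal K (f a) ≠ bitVal K (f b) := by
      cases ha : f a <;> cases hb : f b <;> simp_all [bitVal]
    have := h0 ω
    split_ifs with hA hB
    · exact absurd (hA.symm.trans hB) hne
    all_goals linarith
  rw [sum_add_distrib, h1] at hle
  linarith [h3 a, h3 b]

/-- Adding a Boolean function that is exactly a polynomial of degree `e` to `f` raises the
probabilistic degree by at most `e`. -/
lemma ProbApprox.xor {g h : BoolFun n} (hf : ProbApprox K ε d f)
    (hg : (fun a => bitVal K (g a)) ∈ lowDeg K n e) (hh : ∀ a, h a = xor (f a) (g a)) :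
    ProbApprox K ε (d + e) h := by
  classical
  obtain ⟨Ω, _, w, P, h0, h1, h2, h3⟩ := hf
  refine ⟨Ω, _, w, fun ω a => bitVal K (g a) + P ω a * (1 - 2 * bitVal K (g a)), h0, h1,
    fun ω => ?_, fun a => ?_⟩
  · refine Submodule.add_mem _ (lowDeg_mono (by omega) hg) (mul_mem_lowDeg (h2 ω) ?_)
    exact Submodule.sub_mem _ (const_mem_lowDeg 1) (Submodule.smul_mem _ 2 hg)
  · refine le_trans (sum_le_sum fun ω _ => ?_) (h3 a)
    have := h0 ω
    split_ifs with hA hB hB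
    · exact le_rfl
    · exact this
    · refine absurd ?_ hA
      dsimp only
      rw [hB, hh]
      cases f a <;> cases g a <;> norm_num [bitVal]
    · exact le_rfl

/-- The multilinear extension of the majority function on `2u` bits, ties counting as `1`. -/
def majority {u : ℕ} (y : Fin (2 * u) → K) : K :=
  ∑ A : Finset (Fin (2 * u)) with u ≤ A.card, (∏ i ∈ A, y i) * ∏ i ∈ univ \ A, (1 - y i)

/-- The multilinear majority takes the value of the strict majority of its arguments, whatever
field elements the remaining arguments are. -/
lemma majority_eq {u : ℕ} (y : Fin (2 * u) → K) (v : Bool) (G : Finset (Fin (2 * u)))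
    (hG : u < G.card) (h : ∀ i ∈ G, y i = bitVal K v) : majority y = bitVal K v := by
  have hA : ∀ A : Finset (Fin (2 * u)), (v = false → u ≤ A.card) → (v = true → A.card < u) →
      (∏ i ∈ A, y i) * ∏ i ∈ univ \ A, (1 - y i) = 0 := by
    intro A h0 h1
    cases v with
    | false =>
      obtain ⟨i, hi, hi'⟩ : ∃ i ∈ G, i ∈ A := by
        by_contra! hc
        have hd : Disjoint G A := disjoint_left.mpr hc
        have := card_le_univ (G ∪ A)
        rw [card_union_of_disjoint hd, Fintype.card_fin] at this
        have := h0 rfl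
        omega
      rw [prod_eq_zero hi' (by rw [h i hi]; rfl), zero_mul]
    | true =>
      obtain ⟨i, hi, hi'⟩ : ∃ i ∈ G, i ∉ A := by
        by_contra! hc
        have := card_le_card (show G ⊆ A from hc)
        have := h1 rfl
        omega
      rw [prod_eq_zero (i := i) (s := univ \ A) (by simp [hi']) (by rw [h i hi]; simp [bitVal]),
        mul_zero]
  unfold majority
  cases v with
  | false =>
    rw [sum_eq_zero]
    · rfl
    · intro A hA'
      exact hA A (fun _ => (mem_filter.mp hA').2) (by simp)
  | true =>
    rw [sum_filter_of_ne]
    · have := Finset.prod_add y (fun i => 1 - y i) univ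
      rw [powerset_univ] at this
      rw [← this]
      exact prod_eq_one fun i _ => by ring
    · intro A _ hne
      by_contra hlt
      exact hne (hA A (by simp) (fun _ => by omega))

/-- The factor by which `40` copies reduce the error is at most `ε`; at `ε = 1/3` this amounts to
`4 * (25/27) ^ 19 ≤ 1`. -/
lemma pow_twenty_le (h0 : 0 ≤ ε) (h1 : ε ≤ 1 / 3) : (ε * (2 - ε) ^ 2) ^ 20 ≤ ε := by
  have hx0 : 0 ≤ ε * (2 - ε) ^ 2 := by positivity
  have hx : ε * (2 - ε) ^ 2 ≤ 25 / 27 := by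
    have : 0 ≤ (1 / 3 - ε) * (ε ^ 2 - 11 / 3 * ε + 25 / 9) :=
      mul_nonneg (by linarith) (by nlinarith)
    nlinarith
  have h19 : (ε * (2 - ε) ^ 2) ^ 19 ≤ (25 / 27) ^ 19 := pow_le_pow_left₀ hx0 hx 19
  calc (ε * (2 - ε) ^ 2) ^ 20 = (ε * (2 - ε) ^ 2) ^ 19 * (ε * (2 - ε) ^ 2) := pow_succ _ _
    _ ≤ (25 / 27) ^ 19 * (ε * 4) := by
        refine mul_le_mul h19 (mul_le_mul_of_nonneg_left ?_ h0) hx0 (by positivity)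
        nlinarith
    _ ≤ ε := by norm_num; linarith

/-- Error reduction: the majority of `40k` independent copies has error at most `ε ^ k`. -/
lemma ProbApprox.amplify (h : ProbApprox K ε d f) (hε0 : 0 < ε) (hε : ε ≤ 1 / 3) (k : ℕ) :
    ProbApprox K (ε ^ k) (40 * k * d) f := by
  classical
  obtain ⟨Ω, _, w, P, h0, h1, h2, h3⟩ := h
  set u := 20 * k with hu
  refine ⟨Fin (2 * u) → Ω, inferInstance, fun ω => ∏ i, w (ω i),
    fun ω a => majority fun i => P (ω i) a, fun ω => prod_nonneg fun i _ => h0 _, ?_, fun ω => ?_,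
    fun a => ?_⟩
  · rw [← Fintype.sum_pow, h1, one_pow]
  · have : (fun a => majority fun i => P (ω i) a)
        = ∑ A : Finset (Fin (2 * u)) with u ≤ A.card,
          (∏ i ∈ A, P (ω i)) * ∏ i ∈ univ \ A, (1 - P (ω i)) := by
      funext a; simp [majority]
    dsimp only
    rw [this]
    refine Submodule.sum_mem _ fun A _ => ?_
    have hd1 := prod_mem_lowDeg A (fun i => P (ω i)) (fun _ => d) fun i _ => h2 _
    have hd2 := prod_mem_lowDeg (univ \ A) (fun i => 1 - P (ω i)) (fun _ => d)
      fun i _ => Submodule.sub_mem _ one_mem_lowDeg (h2 _)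
    refine lowDeg_mono ?_ (mul_mem_lowDeg hd1 hd2)
    rw [add_comm, sum_sdiff (subset_univ A), sum_const, card_univ, Fintype.card_fin, smul_eq_mul]
    exact Nat.mul_le_mul_right _ (by omega)
  · -- Markov's inequality for the product of the factors `1/ε`, one for each wrong copy
    let μ : Ω → ℝ := fun ω => if P ω a = bitVal K (f a) then 1 else 1 / ε
    have hμ1 : ∀ ω, 1 ≤ μ ω := by
      intro ω
      dsimp only [μ]
      split_ifs
      · exact le_rfl
      · rw [le_div_iff₀ hε0]; linarith
    have hE : ∑ ω, w ω * μ ω ≤ 2 - ε := by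
      have : ∀ ω, w ω * μ ω
          = w ω + (1 / ε - 1) * (if P ω a = bitVal K (f a) then 0 else w ω) := by
        intro ω; dsimp only [μ]; split_ifs <;> ring
      rw [sum_congr rfl fun ω _ => this ω, sum_add_distrib, h1, ← mul_sum]
      have h4 : (1 / ε - 1) * ∑ ω, (if P ω a = bitVal K (f a) then 0 else w ω)
          ≤ (1 / ε - 1) * ε := by
        refine mul_le_mul_of_nonneg_left (h3 a) ?_
        rw [sub_nonneg, le_div_iff₀ hε0]; linarith
      have h5 : (1 / ε - 1) * ε = 1 - ε := by field_simp
      linarith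
    have hE0 : 0 ≤ ∑ ω, w ω * μ ω :=
      sum_nonneg fun ω _ => mul_nonneg (h0 ω) (zero_le_one.trans (hμ1 ω))
    calc ∑ ω : Fin (2 * u) → Ω, (if majority (fun i => P (ω i) a) = bitVal K (f a) then 0
            else ∏ i, w (ω i))
        ≤ ∑ ω : Fin (2 * u) → Ω, ε ^ u * ∏ i, (w (ω i) * μ (ω i)) := by
          refine sum_le_sum fun ω _ => ?_
          have hw : 0 ≤ ∏ i, w (ω i) := prod_nonneg fun i _ => h0 _
          rw [prod_mul_distrib]
          have hμ0 : 0 ≤ ∏ i, μ (ω i) := prod_nonneg fun i _ => zero_le_one.trans (hμ1 _)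
          split_ifs with hmaj
          · positivity
          · let G : Finset (Fin (2 * u)) := {i | P (ω i) a = bitVal K (f a)}
            have hG : G.card ≤ u := by
              by_contra hlt
              exact hmaj (majority_eq _ (f a) G (by omega) fun i hi => (mem_filter.mp hi).2)
            have hprod : (1 / ε) ^ u ≤ ∏ i, μ (ω i) := by
              have : ∏ i, μ (ω i) = (1 / ε) ^ #Gᶜ := by
                rw [← prod_mul_prod_compl G, prod_eq_one, one_mul, prod_eq_pow_card]
                · intro i hi
                  have : P (ω i) a ≠ bitVal K (f a) := by simpa [G] using hi
                  simp [μ, this]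
                · intro i hi
                  simp [μ, (mem_filter.mp hi).2]
              rw [this]
              refine pow_le_pow_right₀ ?_ ?_
              · rw [le_div_iff₀ hε0]; linarith
              · rw [card_compl, Fintype.card_fin]; omega
            calc ∏ i, w (ω i) = ε ^ u * ((∏ i, w (ω i)) * (1 / ε) ^ u) := by
                  rw [one_div, inv_pow]; field_simp
              _ ≤ _ := by gcongr
      _ = ε ^ u * (∑ ω, w ω * μ ω) ^ (2 * u) := by rw [← mul_sum, Fintype.sum_pow]
      _ ≤ ε ^ u * (2 - ε) ^ (2 * u) := by gcongr
      _ = ((ε * (2 - ε) ^ 2) ^ 20) ^ k := by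
          rw [hu, ← pow_mul, mul_pow, ← pow_mul, ← mul_assoc]
      _ ≤ ε ^ k := pow_le_pow_left₀ (by positivity) (pow_twenty_le hε0.le hε) k

end ProbabilisticPolynomials

/-! ### Tails of the binomial distribution -/

section BinomialEstimates

lemma exp_neg_two_mul_le {x : ℝ} (h0 : 0 ≤ x) (h1 : x ≤ 1 / 2) : Real.exp (-(2 * x)) ≤ 1 - x := by
  rw [Real.exp_neg, inv_le_comm₀ (Real.exp_pos _) (by linarith)]
  refine le_trans ?_ (Real.add_one_le_exp (2 * x))
  rw [inv_le_iff_one_le_mul₀ (by linarith)]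
  nlinarith

lemma choose_sub_lower {w j u : ℕ} (hw : 0 < w) (hj : 4 * j ≤ w) (hu : u ≤ j) :
    ((2 * w).choose w : ℝ) * Real.exp (-(4 * j * u / w)) ≤ (2 * w).choose (w - u) := by
  have hwR : (0 : ℝ) < w := by exact_mod_cast hw
  induction u with
  | zero => simp
  | succ u ih =>
    have ih := ih (by omega)
    have hrec := Nat.choose_succ_right_eq (2 * w) (w - (u + 1))
    rw [show w - (u + 1) + 1 = w - u by omega, show 2 * w - (w - (u + 1)) = w + (u + 1) by omega]
      at hrec
    have hrecR : ((2 * w).choose (w - u) : ℝ) * ((w : ℝ) - u)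
        = (2 * w).choose (w - (u + 1)) * ((w : ℝ) + (u + 1)) := by
      have := congrArg (Nat.cast (R := ℝ)) hrec
      push_cast [Nat.cast_sub (show u ≤ w by omega)] at this
      exact this
    have hujR : (u : ℝ) + 1 ≤ j := by exact_mod_cast hu
    have hjR : 4 * (j : ℝ) ≤ w := by exact_mod_cast hj
    have hratio : Real.exp (-(4 * j / w)) * ((w : ℝ) + (u + 1)) ≤ (w : ℝ) - u := by
      have h1 : Real.exp (-(2 * (2 * j / w))) ≤ 1 - 2 * j / w :=
        exp_neg_two_mul_le (by positivity) (by rw [div_le_iff₀ hwR]; linarith)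
      have h2 : (1 - 2 * j / w) * ((w : ℝ) + (u + 1)) ≤ (w : ℝ) - u := by
        have : (2 * j / w : ℝ) * w = 2 * j := by field_simp
        have h3 : 0 ≤ (2 * j / w : ℝ) * (u + 1) := by positivity
        nlinarith
      rw [show -(4 * (j : ℝ) / w) = -(2 * (2 * j / w)) by ring]
      exact (mul_le_mul_of_nonneg_right h1 (by positivity)).trans h2
    have hpos : (0 : ℝ) < (w : ℝ) + (u + 1) := by positivity
    refine le_of_mul_le_mul_right ?_ hpos
    rw [← hrecR]
    calc ((2 * w).choose w : ℝ) * Real.exp (-(4 * j * ((u + 1 : ℕ) : ℝ) / w)) * (w + (u + 1))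
        = ((2 * w).choose w * Real.exp (-(4 * j * u / w))) *
            (Real.exp (-(4 * j / w)) * (w + (u + 1))) := by
          have : -(4 * j * ((u + 1 : ℕ) : ℝ) / w) = -(4 * j * u / w) + -(4 * j / w) := by
            push_cast; ring
          rw [this, Real.exp_add]; ring
      _ ≤ (2 * w).choose (w - u) * ((w : ℝ) - u) :=
          mul_le_mul ih hratio (by positivity) (by positivity)

/-- A lower bound for the upper tail of the binomial distribution. -/
lemma card_filter_card_lower {w D : ℕ} (hw : 0 < w) (hD : 4 * (D + 1) ≤ w) :
    (4 : ℝ) ^ w * Real.exp (-(4 * (D + 1) ^ 2 / w))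
      ≤ 2 * w * #{I : Finset (Fin (2 * w)) | w + D < I.card} := by
  have h1 := choose_sub_lower hw hD le_rfl
  have h2 : (4 : ℝ) ^ w ≤ 2 * w * (2 * w).choose w := by
    exact_mod_cast Nat.four_pow_le_two_mul_self_mul_centralBinom w hw
  have h3 : (2 * w).choose (w - (D + 1)) ≤ #{I : Finset (Fin (2 * w)) | w + D < I.card} := by
    have hcard : (2 * w).choose (w - (D + 1))
        = #(powersetCard (2 * w - (w - (D + 1))) (univ : Finset (Fin (2 * w)))) := by
      rw [card_powersetCard, card_univ, Fintype.card_fin, Nat.choose_symm (by omega)]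
    rw [hcard]
    refine card_le_card fun I hI => ?_
    rw [mem_powersetCard] at hI
    rw [mem_filter]
    exact ⟨mem_univ _, by have := hI.2; omega⟩
  have h3R : ((2 * w).choose (w - (D + 1)) : ℝ)
      ≤ #{I : Finset (Fin (2 * w)) | w + D < I.card} := by exact_mod_cast h3
  have he : -(4 * ((D : ℝ) + 1) ^ 2 / w) = -(4 * ((D + 1 : ℕ) : ℝ) * ((D + 1 : ℕ) : ℝ) / w) := by
    push_cast; ring
  rw [he]
  calc (4 : ℝ) ^ w * _ ≤ 2 * w * (2 * w).choose w * _ :=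
        mul_le_mul_of_nonneg_right h2 (Real.exp_pos _).le
    _ = 2 * w * ((2 * w).choose w * Real.exp _) := by ring
    _ ≤ _ := by
      have := h1.trans h3R
      gcongr

lemma sum_exp_weight (w : ℕ) (t : ℝ) :
    ∑ a : Fin (2 * w) → Bool, Real.exp (t * ((BoolFun.weight a : ℝ) - w))
      ≤ 4 ^ w * Real.exp (t ^ 2 * w / 4) := by
  have h1 : ∀ a : Fin (2 * w) → Bool, Real.exp (t * ((BoolFun.weight a : ℝ) - w))
      = Real.exp (-(t * w)) * ∏ i, (if a i = true then Real.exp t else 1) := by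
    intro a
    rw [prod_pow_weight, ← Real.exp_nat_mul, ← Real.exp_add]
    congr 1; ring
  have h2 : Real.exp t + 1 = Real.exp (t / 2) * (2 * Real.cosh (t / 2)) := by
    rw [Real.cosh_eq, mul_div_cancel₀ _ (two_ne_zero), mul_add, ← Real.exp_add, ← Real.exp_add]
    simp
  have h3 : Real.exp (-(t * w)) * Real.exp (t / 2) ^ (2 * w) = 1 := by
    rw [← Real.exp_nat_mul, ← Real.exp_add]
    push_cast
    rw [show -(t * (w : ℝ)) + 2 * w * (t / 2) = 0 by ring, Real.exp_zero]
  rw [sum_congr rfl fun a _ => h1 a, ← mul_sum,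
    sum_prod_bool fun _ b => if b = true then Real.exp t else 1]
  simp only [if_true, Bool.false_eq_true, if_false, prod_const, card_univ, Fintype.card_fin]
  rw [h2, mul_pow, ← mul_assoc, h3, one_mul, mul_pow, pow_mul, show (2 : ℝ) ^ 2 = 4 by norm_num]
  refine mul_le_mul_of_nonneg_left ?_ (by positivity)
  calc Real.cosh (t / 2) ^ (2 * w) ≤ Real.exp ((t / 2) ^ 2 / 2) ^ (2 * w) :=
        pow_le_pow_left₀ (Real.cosh_pos _).le (Real.cosh_le_exp_half_sq _) _
    _ = Real.exp (t ^ 2 * w / 4) := by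
        rw [← Real.exp_nat_mul]; congr 1; push_cast; ring

/-- Hoeffding's inequality for the weight of a uniform point of the cube. -/
lemma card_weight_far_le {w : ℕ} (hw : 0 < w) (r : ℕ) :
    (#{a : Fin (2 * w) → Bool | (r : ℝ) ≤ 2 * |(BoolFun.weight a : ℝ) - w|} : ℝ)
      ≤ 2 * 4 ^ w * Real.exp (-((r : ℝ) ^ 2 / (4 * w))) := by
  have hwR : (0 : ℝ) < w := by exact_mod_cast hw
  set t : ℝ := r / w with ht
  have ht0 : 0 ≤ t := by positivity
  have hpt : ∀ a : Fin (2 * w) → Bool, (r : ℝ) ≤ 2 * |(BoolFun.weight a : ℝ) - w| →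
      1 ≤ Real.exp (-(t * r / 2)) * (Real.exp (t * ((BoolFun.weight a : ℝ) - w))
        + Real.exp (-t * ((BoolFun.weight a : ℝ) - w))) := by
    intro a ha
    rw [mul_add, ← Real.exp_add, ← Real.exp_add]
    rcases abs_cases ((BoolFun.weight a : ℝ) - w) with ⟨h, _⟩ | ⟨h, _⟩
    · have : 1 ≤ Real.exp (-(t * r / 2) + t * ((BoolFun.weight a : ℝ) - w)) :=
        Real.one_le_exp (by rw [h] at ha; nlinarith)
      linarith [Real.exp_pos (-(t * r / 2) + -t * ((BoolFun.weight a : ℝ) - w))]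
    · have : 1 ≤ Real.exp (-(t * r / 2) + -t * ((BoolFun.weight a : ℝ) - w)) :=
        Real.one_le_exp (by rw [h] at ha; nlinarith)
      linarith [Real.exp_pos (-(t * r / 2) + t * ((BoolFun.weight a : ℝ) - w))]
  rw [card_eq_sum_ones]
  push_cast
  calc ∑ a : Fin (2 * w) → Bool with (r : ℝ) ≤ 2 * |(BoolFun.weight a : ℝ) - w|, (1 : ℝ)
      ≤ ∑ a : Fin (2 * w) → Bool with (r : ℝ) ≤ 2 * |(BoolFun.weight a : ℝ) - w|,
        Real.exp (-(t * r / 2)) * (Real.exp (t * ((BoolFun.weight a : ℝ) - w))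
        + Real.exp (-t * ((BoolFun.weight a : ℝ) - w))) :=
        sum_le_sum fun a ha => hpt a (mem_filter.mp ha).2
    _ ≤ ∑ a : Fin (2 * w) → Bool,
        Real.exp (-(t * r / 2)) * (Real.exp (t * ((BoolFun.weight a : ℝ) - w))
        + Real.exp (-t * ((BoolFun.weight a : ℝ) - w))) :=
        sum_le_sum_of_subset_of_nonneg (filter_subset _ _) fun a _ _ => by positivity
    _ ≤ Real.exp (-(t * r / 2)) * (4 ^ w * Real.exp (t ^ 2 * w / 4)
        + 4 ^ w * Real.exp ((-t) ^ 2 * w / 4)) := by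
        rw [← mul_sum, sum_add_distrib]
        exact mul_le_mul_of_nonneg_left (add_le_add (sum_exp_weight w t) (sum_exp_weight w (-t)))
          (Real.exp_pos _).le
    _ = 2 * 4 ^ w * (Real.exp (-(t * r / 2)) * Real.exp (t ^ 2 * w / 4)) := by
        rw [neg_sq]; ring
    _ = 2 * 4 ^ w * Real.exp (-((r : ℝ) ^ 2 / (4 * w))) := by
        rw [← Real.exp_add]
        congr 2
        rw [ht]; field_simp; ring

end BinomialEstimates

/-! ### Smolensky's bound for geometric spectra -/

section Core

variable {K : Type*} [Field K] {n d : ℕ} {ε : ℝ} {f : BoolFun n}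

/-- Some member of a probabilistic polynomial has few errors in total over a family of subcubes. -/
lemma ProbApprox.exists_few_errors [DecidableEq K] (h : ProbApprox K ε d f) (m : ℕ)
    (J : Finset ℕ) :
    ∃ φ ∈ lowDeg K n d,
      (∑ j ∈ J, #{a : Fin m → Bool | φ (extend n j a) ≠ bitVal K (f (extend n j a))} : ℝ)
        ≤ J.card * 2 ^ m * ε := by
  classical
  obtain ⟨Ω, _, w, P, h0, h1, h2, h3⟩ := h
  by_contra! hc
  have hlt : ∀ ω, (J.card * 2 ^ m * ε : ℝ) < ∑ j ∈ J, ∑ a : Fin m → Bool,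
      (if P ω (extend n j a) = bitVal K (f (extend n j a)) then 0 else 1) := by
    intro ω
    refine (hc (P ω) (h2 ω)).trans_le (le_of_eq (sum_congr rfl fun j _ => ?_))
    rw [card_filter]
    push_cast
    exact sum_congr rfl fun a _ => by
      by_cases hP : P ω (extend n j a) = bitVal K (f (extend n j a)) <;> simp [hP]
  have hpos : ∃ ω, 0 < w ω := by
    by_contra! hw
    have := sum_nonpos fun ω (_ : ω ∈ univ) => hw ω
    linarith
  have hA : ∑ ω, w ω * (J.card * 2 ^ m * ε : ℝ) < ∑ ω, w ω * ∑ j ∈ J, ∑ a : Fin m → Bool,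
      (if P ω (extend n j a) = bitVal K (f (extend n j a)) then 0 else 1) := by
    obtain ⟨ω₀, hω₀⟩ := hpos
    exact sum_lt_sum (fun ω _ => mul_le_mul_of_nonneg_left (hlt ω).le (h0 ω))
      ⟨ω₀, mem_univ _, mul_lt_mul_of_pos_left (hlt ω₀) hω₀⟩
  have hB : ∑ ω, w ω * ∑ j ∈ J, ∑ a : Fin m → Bool,
      (if P ω (extend n j a) = bitVal K (f (extend n j a)) then (0 : ℝ) else 1)
      = ∑ j ∈ J, ∑ a : Fin m → Bool, ∑ ω,
        (if P ω (extend n j a) = bitVal K (f (extend n j a)) then 0 else w ω) := by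
    simp only [mul_sum]
    rw [sum_comm]
    refine sum_congr rfl fun j _ => ?_
    rw [sum_comm]
    exact sum_congr rfl fun a _ => sum_congr rfl fun ω _ => by split_ifs <;> simp
  rw [← sum_mul, h1, one_mul, hB] at hA
  have hC : ∑ j ∈ J, ∑ a : Fin m → Bool, ∑ ω,
        (if P ω (extend n j a) = bitVal K (f (extend n j a)) then 0 else w ω)
      ≤ ∑ j ∈ J, ∑ a : Fin m → Bool, ε :=
    sum_le_sum fun j _ => sum_le_sum fun a _ =>
      (le_of_eq (sum_congr rfl fun ω _ => by congr)).trans (h3 (extend n j a))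
  simp only [sum_const, card_univ, Fintype.card_fun, Fintype.card_fin, Fintype.card_bool,
    nsmul_eq_mul] at hC
  push_cast at hC
  linarith

lemma weight_le {m : ℕ} (a : Fin m → Bool) : BoolFun.weight a ≤ m := by
  simpa [BoolFun.weight] using card_le_univ (univ.filter fun i => a i = true)

lemma lt_two_pow_log (n : ℕ) : n < 2 ^ (Nat.log 2 n + 1) := Nat.lt_pow_succ_log_self one_lt_two n

/-- The central estimate. Suppose that a linear combination of restrictions of `f` to `2w`
variables agrees with `z ^ |a|` at all weights within distance about `r / 2` of `w`, where
`z ≠ 0, 1`. Then Smolensky's argument bounds the probabilistic degree of `f` from below. The factor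
`201 * (Nat.log 2 n + 1)` is the cost of reducing the error from `ε` to less than `ε / n ^ 3`. -/
lemma ProbApprox.smolensky (h : ProbApprox K ε d f) (hf : f.IsSymmetric) (hd : 1 ≤ d)
    (hε0 : 0 < ε) (hε : ε ≤ 1 / 3) {w : ℕ} (hw : 0 < w) (hwn : 2 * w ≤ n)
    {z : K} (hz0 : z ≠ 0) (hz1 : z ≠ 1)
    (J : Finset ℕ) (hJ : ∀ j ∈ J, j + 2 * w ≤ n) (c : ℕ → K) (r : ℕ)
    (hc : ∀ i, (2 * w + 1 - r) / 2 ≤ i → i < (2 * w + 1 - r) / 2 + r →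
      ∑ j ∈ J, c j * bitVal K (f.spec (i + j)) = z ^ i)
    (hr : 2 * w < r ∨
      4 * w * (Real.log (1 / ε) + 3 * (Nat.log 2 n + 1 : ℕ)) ≤ (r : ℝ) ^ 2) :
    w ≤ 4 * (201 * (Nat.log 2 n + 1) * d) ∨
      w * Real.log (1 / ε) ≤ 4 * ((201 * (Nat.log 2 n + 1) * d : ℕ) : ℝ) ^ 2 := by
  classical
  set lam := Nat.log 2 n + 1 with hlam
  have hlam1 : 1 ≤ lam := by omega
  set D := 40 * (1 + 4 * lam) * d with hD
  have hDM : D + 1 ≤ 201 * lam * d := by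
    have h1 : 1 ≤ lam * d := Nat.mul_pos hlam1 hd
    have h2 : d ≤ lam * d := Nat.le_mul_of_pos_left d hlam1
    have : D = 40 * d + 160 * (lam * d) := by rw [hD]; ring
    have : 201 * lam * d = 201 * (lam * d) := by ring
    omega
  have hwR : (0 : ℝ) < w := by exact_mod_cast hw
  -- the estimate of the binomial tail needs `4 (D + 1) ≤ w`
  by_cases hDw : w < 4 * (D + 1)
  · left; omega
  right
  push Not at hDw
  obtain ⟨φ, hφ, herr⟩ := (h.amplify hε0 hε (1 + 4 * lam)).exists_few_errors (2 * w) J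
  let ψ : (Fin (2 * w) → Bool) → K := ∑ j ∈ J, c j • fun a => φ (extend n j a)
  have hψ : ψ ∈ lowDeg K (2 * w) D :=
    Submodule.sum_mem _ fun j _ => Submodule.smul_mem _ _ (comp_extend_mem_lowDeg j hφ)
  -- the points whose weight is outside the window where the combination is prescribed
  set far : Finset (Fin (2 * w) → Bool) :=
    {a | (r : ℝ) ≤ 2 * |(BoolFun.weight a : ℝ) - w| ∧ r ≤ 2 * w} with hfar
  have hsub : ({a | ψ a ≠ z ^ BoolFun.weight a} : Finset (Fin (2 * w) → Bool)) ⊆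
      far ∪ J.biUnion fun j =>
        {a : Fin (2 * w) → Bool | φ (extend n j a) ≠ bitVal K (f (extend n j a))} := by
    intro a ha
    rw [mem_filter] at ha
    by_contra hmem
    simp only [hfar, mem_union, mem_filter, mem_univ, true_and, mem_biUnion, not_or, not_exists,
      not_and, not_not] at hmem
    obtain ⟨hnear, hgood⟩ := hmem
    refine ha.2 ?_
    have h1 : ψ a = ∑ j ∈ J, c j * bitVal K (f.spec (BoolFun.weight a + j)) := by
      simp only [ψ, Finset.sum_apply, Pi.smul_apply, smul_eq_mul]
      refine sum_congr rfl fun j hj => ?_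
      rw [hgood j hj, BoolFun.eq_spec_weight hf, weight_extend (hJ j hj)]
    have hwt := weight_le a
    rw [h1]
    by_cases hr2 : r ≤ 2 * w
    · have hlt : 2 * |(BoolFun.weight a : ℝ) - w| < r := by
        by_contra hge
        exact hnear (not_lt.mp hge) hr2
      rcases abs_cases ((BoolFun.weight a : ℝ) - w) with ⟨he, _⟩ | ⟨he, _⟩
      · rw [he] at hlt
        have hlt' : 2 * BoolFun.weight a < r + 2 * w := by
          have : (2 * BoolFun.weight a : ℝ) < r + 2 * w := by linarith
          exact_mod_cast this
        have hge' : w ≤ BoolFun.weight a := by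
          have : (w : ℝ) ≤ BoolFun.weight a := by linarith
          exact_mod_cast this
        exact hc _ (by omega) (by omega)
      · rw [he] at hlt
        have hlt' : 2 * w < r + 2 * BoolFun.weight a := by
          have : (2 * w : ℝ) < r + 2 * BoolFun.weight a := by linarith
          exact_mod_cast this
        have hge' : BoolFun.weight a < w := by
          have : (BoolFun.weight a : ℝ) < w := by linarith
          exact_mod_cast this
        exact hc _ (by omega) (by omega)
    · exact hc _ (by omega) (by omega)
  have hJn : (J.card : ℝ) ≤ n := by
    have : J ⊆ range n := fun j hj => mem_range.mpr (by have := hJ j hj; omega)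
    have := card_le_card this
    rw [card_range] at this
    exact_mod_cast this
  have hnlam : (n : ℝ) ≤ 2 ^ lam := by exact_mod_cast (lt_two_pow_log n).le
  have hwnR : 2 * (w : ℝ) ≤ n := by exact_mod_cast hwn
  have hlogε : Real.exp (-Real.log (1 / ε)) = ε := by
    rw [one_div, Real.log_inv, neg_neg, Real.exp_log hε0]
  have h2lam : (2 : ℝ) ≤ 2 ^ lam := by
    calc (2 : ℝ) = 2 ^ 1 := by norm_num
      _ ≤ 2 ^ lam := pow_le_pow_right₀ (by norm_num) hlam1
  have hfarcard : 2 * w * (far.card : ℝ) ≤ 4 ^ w * (ε / 2) := by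
    by_cases hr2 : r ≤ 2 * w
    · have hr' := hr.resolve_left (by omega)
      have h1 : (far.card : ℝ) ≤ 2 * 4 ^ w * Real.exp (-((r : ℝ) ^ 2 / (4 * w))) := by
        refine le_trans ?_ (card_weight_far_le hw r)
        have hsub' : far ⊆ ({a | (r : ℝ) ≤ 2 * |(BoolFun.weight a : ℝ) - w|} :
            Finset (Fin (2 * w) → Bool)) := fun a ha => by
          rw [hfar, mem_filter] at ha
          exact mem_filter.mpr ⟨mem_univ a, ha.2.1⟩
        exact Nat.cast_le.mpr (card_le_card hsub')
      have h2 : Real.exp (-((r : ℝ) ^ 2 / (4 * w))) ≤ ε * (1 / 8 ^ lam) := by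
        have h3 : Real.log (1 / ε) + 3 * (lam : ℝ) ≤ (r : ℝ) ^ 2 / (4 * w) := by
          rw [le_div_iff₀ (by positivity)]; linarith
        have h4 : Real.exp (-(3 * (lam : ℝ))) ≤ 1 / 8 ^ lam := by
          rw [Real.exp_neg, one_div]
          refine inv_anti₀ (by positivity) ?_
          rw [mul_comm, Real.exp_nat_mul]
          refine pow_le_pow_left₀ (by norm_num) ?_ lam
          have : Real.exp 3 = Real.exp 1 ^ 3 := by rw [← Real.exp_nat_mul]; norm_num
          rw [this]
          calc (8 : ℝ) = 2 ^ 3 := by norm_num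
            _ ≤ Real.exp 1 ^ 3 :=
              pow_le_pow_left₀ (by norm_num) (by linarith [Real.add_one_le_exp (1 : ℝ)]) 3
        calc Real.exp (-((r : ℝ) ^ 2 / (4 * w)))
            ≤ Real.exp (-Real.log (1 / ε) + -(3 * (lam : ℝ))) :=
              Real.exp_le_exp.mpr (by linarith)
          _ ≤ ε * (1 / 8 ^ lam) := by
              rw [Real.exp_add, hlogε]; gcongr
      have h8 : (8 : ℝ) ^ lam = 2 ^ lam * (2 ^ lam * 2 ^ lam) := by
        rw [← mul_pow, ← mul_pow]; norm_num
      have h9 : 2 * w * (1 / (8 : ℝ) ^ lam) ≤ 1 / 4 := by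
        rw [mul_one_div, div_le_iff₀ (by positivity), h8]
        have : (4 : ℝ) ≤ 2 ^ lam * 2 ^ lam := by nlinarith
        nlinarith [pow_pos (show (0 : ℝ) < 2 by norm_num) lam]
      calc 2 * w * (far.card : ℝ) ≤ 2 * w * (2 * 4 ^ w * (ε * (1 / 8 ^ lam))) := by
            have := h1.trans (mul_le_mul_of_nonneg_left h2 (by positivity))
            gcongr
        _ = 4 ^ w * (2 * ε) * (2 * w * (1 / 8 ^ lam)) := by ring
        _ ≤ 4 ^ w * (2 * ε) * (1 / 4) := by gcongr
        _ = 4 ^ w * (ε / 2) := by ring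
    · have : far = ∅ := by
        rw [hfar, filter_eq_empty_iff]
        exact fun a _ ha => hr2 ha.2
      rw [this]
      simp only [card_empty, Nat.cast_zero, mul_zero]
      positivity
  have hbad : 2 * w * ((J.card : ℝ) * 2 ^ (2 * w) * ε ^ (1 + 4 * lam)) ≤ 4 ^ w * (ε / 2) := by
    have h4 : (2 : ℝ) ^ (2 * w) = 4 ^ w := by rw [pow_mul]; norm_num
    have hε4 : ε ^ (4 * lam) ≤ 1 / 8 ^ lam := by
      rw [pow_mul, ← one_div_pow]
      refine pow_le_pow_left₀ (by positivity) ?_ lam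
      calc ε ^ 4 ≤ (1 / 3) ^ 4 := pow_le_pow_left₀ hε0.le hε 4
        _ ≤ 1 / 8 := by norm_num
    have h8 : (8 : ℝ) ^ lam = 2 ^ lam * (2 ^ lam * 2 ^ lam) := by
      rw [← mul_pow, ← mul_pow]; norm_num
    have h9 : (n : ℝ) * n * (1 / 8 ^ lam) ≤ 1 / 2 := by
      rw [mul_one_div, div_le_iff₀ (by positivity), h8]
      have h10 : (n : ℝ) * n ≤ 2 ^ lam * 2 ^ lam := by gcongr
      nlinarith [pow_pos (show (0 : ℝ) < 2 by norm_num) lam]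
    calc 2 * w * ((J.card : ℝ) * 2 ^ (2 * w) * ε ^ (1 + 4 * lam))
        ≤ n * (n * 4 ^ w * (ε * (1 / 8 ^ lam))) := by
          rw [h4, pow_add, pow_one]; gcongr
      _ = 4 ^ w * ε * (n * n * (1 / 8 ^ lam)) := by ring
      _ ≤ 4 ^ w * ε * (1 / 2) := by gcongr
      _ = 4 ^ w * (ε / 2) := by ring
  -- half of `ε` is spent on the tail and half on the errors of the restrictions
  have hcard : (#{a : Fin (2 * w) → Bool | ψ a ≠ z ^ BoolFun.weight a} : ℝ)
      ≤ far.card + J.card * 2 ^ (2 * w) * ε ^ (1 + 4 * lam) := by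
    have h1 := (card_le_card hsub).trans ((card_union_le _ _).trans
      (Nat.add_le_add_left card_biUnion_le _))
    have h2 : (#{a : Fin (2 * w) → Bool | ψ a ≠ z ^ BoolFun.weight a} : ℝ) ≤ far.card +
        ∑ j ∈ J, (#{a : Fin (2 * w) → Bool |
          φ (extend n j a) ≠ bitVal K (f (extend n j a))} : ℝ) := by exact_mod_cast h1
    linarith
  have htail := card_filter_card_lower hw hDw
  have hsmol : (#{I : Finset (Fin (2 * w)) | w + D < I.card} : ℝ)
      ≤ #{a : Fin (2 * w) → Bool | ψ a ≠ z ^ BoolFun.weight a} := by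
    exact_mod_cast card_filter_card_le_card_ne hz0 hz1 hψ
  have hfinal : (4 : ℝ) ^ w * Real.exp (-(4 * (D + 1) ^ 2 / w)) ≤ 4 ^ w * ε := by
    refine htail.trans ?_
    calc 2 * w * (#{I : Finset (Fin (2 * w)) | w + D < I.card} : ℝ)
        ≤ 2 * w * (far.card + J.card * 2 ^ (2 * w) * ε ^ (1 + 4 * lam)) := by
          have := hsmol.trans hcard
          gcongr
      _ = 2 * w * far.card + 2 * w * (J.card * 2 ^ (2 * w) * ε ^ (1 + 4 * lam)) := by ring
      _ ≤ 4 ^ w * (ε / 2) + 4 ^ w * (ε / 2) := add_le_add hfarcard hbad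
      _ = 4 ^ w * ε := by ring
  have hexp := le_of_mul_le_mul_left hfinal (by positivity)
  have hexp := hexp.trans_eq hlogε.symm
  rw [Real.exp_le_exp, neg_le_neg_iff, le_div_iff₀ hwR] at hexp
  have hDR : ((D : ℝ) + 1) ≤ ((201 * lam * d : ℕ) : ℝ) := by exact_mod_cast hDM
  have hsq : ((D : ℝ) + 1) ^ 2 ≤ ((201 * lam * d : ℕ) : ℝ) ^ 2 :=
    pow_le_pow_left₀ (by positivity) hDR 2
  linarith

end Core

/-! ### Windows of the spectrum -/

/-- The windows `(s j, …, s (j + r - 1))` of length `r` of the sequence `s`, at the offsets `j ∈ J`,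
span `Kʳ`. -/
def WindowsSpan {K : Type*} [Field K] (s : ℕ → K) (J : Finset ℕ) (r : ℕ) : Prop :=
  ∀ t : ℕ → K, ∃ c : ℕ → K, ∀ i < r, ∑ j ∈ J, c j * s (i + j) = t i

section Parameters

variable {K : Type*} [Field K] {n d : ℕ} {ε : ℝ} {f : BoolFun n}

lemma one_le_log_one_div (hε0 : 0 < ε) (hε : ε ≤ 1 / 3) : 1 ≤ Real.log (1 / ε) := by
  rw [Real.le_log_iff_exp_le (by positivity)]
  have h1 : (3 : ℝ) ≤ 1 / ε := by rw [le_div_iff₀ hε0]; linarith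
  linarith [Real.exp_one_lt_d9]

lemma log_one_div_le (hε : 1 / 2 ^ n ≤ ε) : Real.log (1 / ε) ≤ n := by
  have hε0 : 0 < ε := lt_of_lt_of_le (by positivity) hε
  have h1 : 1 / ε ≤ 2 ^ n := by
    rw [div_le_iff₀ hε0]; rwa [div_le_iff₀ (by positivity), mul_comm] at hε
  calc Real.log (1 / ε) ≤ Real.log (2 ^ n) := Real.log_le_log (by positivity) h1
    _ = n * Real.log 2 := by rw [Real.log_pow]
    _ ≤ n * 1 := by
        refine mul_le_mul_of_nonneg_left ?_ (Nat.cast_nonneg n)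
        linarith [Real.log_two_lt_d9]
    _ = n := mul_one _

/-- If a window of `r` weights can be prescribed by restrictions of `f`, then so can the values
`z ^ |a|` at the `r` middle weights of `2w` variables. -/
lemma ProbApprox.smolensky_of_windowsSpan (h : ProbApprox K ε d f) (hf : f.IsSymmetric)
    (hd : 1 ≤ d) (hε0 : 0 < ε) (hε : ε ≤ 1 / 3) {z : K} (hz0 : z ≠ 0) (hz1 : z ≠ 1)
    {A B r : ℕ} (hspan : WindowsSpan (fun i => bitVal K (f.spec i)) (Icc A B) r)
    (hr1 : 1 ≤ r) (hAB : A + B + r ≤ n + 1) {w : ℕ} (hw : 0 < w)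
    (hr : 2 * w < r ∨ (w ≤ A ∧
      4 * w * (Real.log (1 / ε) + 3 * (Nat.log 2 n + 1 : ℕ)) ≤ (r : ℝ) ^ 2))
    (hwn : 2 * w ≤ n) :
    w ≤ 4 * (201 * (Nat.log 2 n + 1) * d) ∨
      w * Real.log (1 / ε) ≤ 4 * ((201 * (Nat.log 2 n + 1) * d : ℕ) : ℝ) ^ 2 := by
  have hwA : 2 * w < r ∨ w ≤ A := hr.imp_right And.left
  -- the window starts at weight `x`, which truncates to `0` if it covers all weights
  set x := (2 * w + 1 - r) / 2 with hx
  have hxA : x ≤ A := by omega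
  obtain ⟨c, hc⟩ := hspan fun i => z ^ (i + x)
  have hinj : Set.InjOn (fun j => j - x) (Icc A B : Finset ℕ) := by
    intro i hi j hj hij
    simp only [coe_Icc, Set.mem_Icc] at hi hj hij
    omega
  refine h.smolensky hf hd hε0 hε hw hwn hz0 hz1 ((Icc A B).image fun j => j - x) ?_
    (fun j => c (j + x)) r ?_ (hr.imp_right And.right)
  · intro j hj
    obtain ⟨i, hi, rfl⟩ := mem_image.mp hj
    rw [mem_Icc] at hi
    omega
  · intro i hi1 hi2
    rw [sum_image hinj]
    have := hc (i - x) (by omega)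
    rw [show i - x + x = i by omega] at this
    rw [← this]
    refine sum_congr rfl fun j hj => ?_
    rw [mem_Icc] at hj
    rw [show j - x + x = j by omega, show i + (j - x) = i - x + j by omega]

/-- The number of variables is optimized in `ProbApprox.smolensky_of_windowsSpan`: either about
`r ^ 2 / log (1 / ε)`, so that the weights outside the window have probability less than `ε`, or
all available ones if there are fewer. If `r` is below `log (1 / ε)`, the window covers all
weights. -/
lemma ProbApprox.le_or_le_of_windowsSpan (h : ProbApprox K ε d f) (hf : f.IsSymmetric)
    (hd : 1 ≤ d) (hε0 : 1 / 2 ^ n ≤ ε) (hε : ε ≤ 1 / 3) {z : K} (hz0 : z ≠ 0) (hz1 : z ≠ 1)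
    {A B r : ℕ} (hspan : WindowsSpan (fun i => bitVal K (f.spec i)) (Icc A B) r)
    (hAB : A + B + r ≤ n + 1) (hA : n ≤ 16 * A) (hA2 : 2 * A ≤ n) (hn : 0 < n) :
    (r : ℝ) ≤ 28 * (Nat.log 2 n + 1 : ℕ) * (201 * (Nat.log 2 n + 1) * d : ℕ) ∨
      n * Real.log (1 / ε) ≤ 4096 * ((201 * (Nat.log 2 n + 1) * d : ℕ) : ℝ) ^ 2 := by
  have hεpos : 0 < ε := lt_of_lt_of_le (by positivity) hε0
  have hl1 := one_le_log_one_div hεpos hε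
  have hln := log_one_div_le hε0
  have key := fun w hw hr hwn (hr1 : 1 ≤ r) =>
    h.smolensky_of_windowsSpan hf hd hεpos hε hz0 hz1 hspan hr1 hAB (w := w) hw hr hwn
  set lam := Nat.log 2 n + 1 with hlam
  set M := 201 * lam * d with hM
  set l := Real.log (1 / ε) with hl
  have hlam1 : (1 : ℝ) ≤ lam := by exact_mod_cast (show 1 ≤ lam by omega)
  have hM1N : 201 ≤ M := by
    have : 0 < lam * d := Nat.mul_pos (by omega) hd
    calc 201 ≤ 201 * (lam * d) := Nat.le_mul_of_pos_right _ this
      _ = M := by rw [hM]; ring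
  have hM1 : (201 : ℝ) ≤ M := by exact_mod_cast hM1N
  have hMlam : (M : ℝ) ≤ lam * M := le_mul_of_one_le_left (by positivity) hlam1
  have hsq : (r : ℝ) ^ 2 ≤ 784 * (lam * (M : ℝ) ^ 2) → (r : ℝ) ≤ 28 * lam * M := by
    intro hr
    have h1 : (lam : ℝ) * (M : ℝ) ^ 2 ≤ (lam : ℝ) ^ 2 * (M : ℝ) ^ 2 := by gcongr; nlinarith
    refine (abs_le_of_sq_le_sq' ?_ (by positivity)).2
    calc (r : ℝ) ^ 2 ≤ 784 * ((lam : ℝ) ^ 2 * (M : ℝ) ^ 2) := by linarith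
      _ = (28 * lam * M : ℝ) ^ 2 := by ring
  by_cases hr3 : r < 3
  · left
    have : (r : ℝ) ≤ 3 := by exact_mod_cast hr3.le
    linarith
  have hr3R : (3 : ℝ) ≤ r := by exact_mod_cast (not_lt.mp hr3)
  have hΛ : l + 3 * lam ≤ 4 * lam * l := by nlinarith
  by_cases hr8 : (r : ℝ) < 8 * (l + 3 * lam)
  · left
    obtain ⟨w, hw⟩ : ∃ w, w = (r - 1) / 2 := ⟨_, rfl⟩
    have hw6 : (r : ℝ) ≤ 6 * w := by exact_mod_cast (show r ≤ 6 * w by omega)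
    rcases key w (by omega) (Or.inl (by omega)) (by omega) (by omega) with h1 | h1
    · have : (w : ℝ) ≤ 4 * M := by exact_mod_cast h1
      linarith
    · refine hsq ?_
      have h2 : (r : ℝ) ^ 2 ≤ 32 * lam * (6 * (w * l)) := by
        have h3 : (r : ℝ) ≤ 32 * lam * l := by linarith
        calc (r : ℝ) ^ 2 = r * r := sq _
          _ ≤ (6 * w) * (32 * lam * l) := by gcongr
          _ = _ := by ring
      have h4 : 32 * lam * (6 * (w * l)) ≤ 32 * lam * (6 * (4 * (M : ℝ) ^ 2)) := by gcongr
      have h5 : (0 : ℝ) ≤ lam * (M : ℝ) ^ 2 := by positivity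
      linarith
  push Not at hr8
  have hΛ0 : 0 < l + 3 * lam := by linarith
  -- the largest number of variables for which the weights outside the window are negligible
  obtain ⟨w₁, hw₁⟩ : ∃ w₁, w₁ = ⌊(r : ℝ) ^ 2 / (4 * (l + 3 * lam))⌋₊ := ⟨_, rfl⟩
  have hw₁le : (w₁ : ℝ) ≤ (r : ℝ) ^ 2 / (4 * (l + 3 * lam)) := by
    rw [hw₁]; exact Nat.floor_le (by positivity)
  have hw₁lt : (r : ℝ) ^ 2 / (4 * (l + 3 * lam)) < w₁ + 1 := by
    rw [hw₁]; exact Nat.lt_floor_add_one _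
  rw [le_div_iff₀ (by positivity)] at hw₁le
  have h2r : 2 * (r : ℝ) ≤ (r : ℝ) ^ 2 / (4 * (l + 3 * lam)) := by
    rw [le_div_iff₀ (by positivity)]; nlinarith
  have hrw₁ : (r : ℝ) ≤ w₁ := by linarith
  have hw₁0 : 0 < w₁ := by
    have : (0 : ℝ) < w₁ := by linarith
    exact_mod_cast this
  have hwfloor : (r : ℝ) ^ 2 ≤ 8 * (l + 3 * lam) * w₁ := by
    rw [div_lt_iff₀ (by positivity)] at hw₁lt
    have : (1 : ℝ) ≤ w₁ := by linarith
    nlinarith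
  by_cases hcase : w₁ ≤ A
  · left
    rcases key w₁ hw₁0 (Or.inr ⟨hcase, by linarith⟩) (by omega) (by omega) with h1 | h1
    · have : (w₁ : ℝ) ≤ 4 * M := by exact_mod_cast h1
      linarith
    · refine hsq ?_
      have h2 : (r : ℝ) ^ 2 ≤ 32 * lam * (w₁ * l) := by
        have := mul_le_mul_of_nonneg_right hΛ (Nat.cast_nonneg (α := ℝ) w₁)
        linarith
      have h4 : 32 * lam * (w₁ * l) ≤ 32 * lam * (4 * (M : ℝ) ^ 2) := by gcongr
      have h5 : (0 : ℝ) ≤ lam * (M : ℝ) ^ 2 := by positivity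
      linarith
  · right
    push Not at hcase
    have hAR : (n : ℝ) ≤ 16 * A := by exact_mod_cast hA
    have hAw : (A : ℝ) ≤ w₁ := by exact_mod_cast hcase.le
    have hAr : 4 * A * (l + 3 * lam) ≤ (r : ℝ) ^ 2 := by
      have := mul_le_mul_of_nonneg_right hAw hΛ0.le
      linarith
    rcases key A (by omega) (Or.inr ⟨le_rfl, hAr⟩) hA2 (by omega) with h1 | h1
    · have : (A : ℝ) ≤ 4 * M := by exact_mod_cast h1
      have h2 : (n : ℝ) ≤ 64 * M := by linarith
      calc n * l ≤ n * n := by gcongr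
        _ ≤ (64 * M) * (64 * M) := by gcongr
        _ = 4096 * (M : ℝ) ^ 2 := by ring
    · have : n * l ≤ 16 * A * l := by gcongr
      have : (0 : ℝ) ≤ (M : ℝ) ^ 2 := by positivity
      linarith

end Parameters

/-! ### Linear recurrences on intervals -/

/-- The shift operator on sequences. -/
def shift (R : Type*) [CommRing R] : Module.End R (ℕ → R) := LinearMap.funLeft R R Nat.succ

/-- The action of a polynomial on sequences, the variable acting as the shift. -/
noncomputable def act {R : Type*} [CommRing R] (q : R[X]) (s : ℕ → R) : ℕ → R :=
  aeval (shift R) q s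

/-- The recurrence with characteristic polynomial `q` holds for `s` on the interval `[j₀, j₁]`. -/
def Kills {R : Type*} [CommRing R] (q : R[X]) (s : ℕ → R) (j₀ j₁ : ℕ) : Prop :=
  ∀ j, j₀ ≤ j → j + q.natDegree ≤ j₁ → act q s j = 0

section Recurrences

lemma shift_pow_apply {R : Type*} [CommRing R] (i : ℕ) (s : ℕ → R) (j : ℕ) :
    (shift R ^ i) s j = s (j + i) := by
  induction i generalizing j with
  | zero => simp
  | succ i ih =>
    rw [pow_succ', Module.End.mul_apply]
    change (shift R ^ i) s (j + 1) = _
    rw [ih]; congr 1; ring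

lemma act_apply {R : Type*} [CommRing R] (q : R[X]) (s : ℕ → R) {N : ℕ} (hN : q.natDegree < N)
    (j : ℕ) : act q s j = ∑ i ∈ range N, q.coeff i * s (j + i) := by
  rw [act, aeval_eq_sum_range' hN, LinearMap.sum_apply, Finset.sum_apply]
  refine sum_congr rfl fun i _ => ?_
  rw [LinearMap.smul_apply, Pi.smul_apply, shift_pow_apply, smul_eq_mul]

lemma act_mul {R : Type*} [CommRing R] (p q : R[X]) (s : ℕ → R) :
    act (p * q) s = act p (act q s) := by
  rw [act, map_mul, Module.End.mul_apply]; rfl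

lemma act_X_pow_sub_one {R : Type*} [CommRing R] (m : ℕ) (s : ℕ → R) (j : ℕ) :
    act (X ^ m - 1) s j = s (j + m) - s j := by
  rw [act, map_sub, map_pow, aeval_X, map_one, LinearMap.sub_apply, Pi.sub_apply, shift_pow_apply]
  rfl

lemma act_map {R S : Type*} [CommRing R] [CommRing S] (φ : R →+* S) (q : R[X]) (s : ℕ → R)
    (j : ℕ) : act (q.map φ) (fun i => φ (s i)) j = φ (act q s j) := by
  rw [act_apply _ _ (lt_of_le_of_lt natDegree_map_le (Nat.lt_succ_self _)),
    act_apply q s (Nat.lt_succ_self _), map_sum]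
  simp

lemma Kills.mul_left {R : Type*} [CommRing R] [IsDomain R] {q : R[X]} {s : ℕ → R} {j₀ j₁ : ℕ}
    (h : Kills q s j₀ j₁) {p : R[X]} (hp : p ≠ 0) (hq : q ≠ 0) : Kills (p * q) s j₀ j₁ := by
  intro j hj0 hj1
  rw [natDegree_mul hp hq] at hj1
  rw [act_mul, act_apply p _ (Nat.lt_succ_self _)]
  refine sum_eq_zero fun i hi => ?_
  rw [mem_range] at hi
  rw [h (j + i) (by omega) (by omega), mul_zero]

variable {K : Type*} [Field K]

/-- A linear recurrence on an interval, whose characteristic polynomial does not vanish at `0`,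
either is a divisor of a power of `X - 1`, or some polynomial in the shift turns the sequence into
the geometric sequence of a root `z ≠ 0, 1`. -/
lemma Kills.eigen_or_unipotent [IsAlgClosed K] {s : ℕ → K} {j₀ j₁ : ℕ} {q : K[X]}
    (hq : q.coeff 0 ≠ 0) (h : Kills q s j₀ j₁) :
    (∃ z : K, z ≠ 0 ∧ z ≠ 1 ∧ ∃ u : K[X], u.natDegree ≤ q.natDegree ∧
      ∀ i, j₀ + i + q.natDegree ≤ j₁ + 1 → act u s (j₀ + i) = z ^ i) ∨
    ∃ k ≤ q.natDegree, Kills ((X - 1) ^ k) s j₀ j₁ := by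
  induction hN : q.natDegree using Nat.strong_induction_on generalizing q with
  | _ N ih =>
  have hq0 : q ≠ 0 := fun h0 => hq (by simp [h0])
  by_cases hroot : ∃ z ∈ q.roots, z ≠ 1
  · obtain ⟨z, hz, hz1⟩ := hroot
    have hzroot : q.IsRoot z := (mem_roots hq0).mp hz
    have hz0 : z ≠ 0 := by
      rintro rfl
      exact hq (by rw [coeff_zero_eq_eval_zero]; exact hzroot)
    obtain ⟨p, hp⟩ := dvd_iff_isRoot.mpr hzroot
    have hp0 : p ≠ 0 := by rintro rfl; exact hq0 (by simp [hp])
    have hdeg : q.natDegree = p.natDegree + 1 := by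
      rw [hp, natDegree_mul (X_sub_C_ne_zero z) hp0, natDegree_X_sub_C, add_comm]
    have hpc : p.coeff 0 ≠ 0 := by
      intro h0
      exact hq (by rw [hp, mul_coeff_zero, h0, mul_zero])
    by_cases hpk : Kills p s j₀ j₁
    · rcases ih p.natDegree (by omega) hpc hpk rfl with ⟨z', h0, h1, u, hu, hact⟩ | ⟨k, hk, hkill⟩
      · exact Or.inl ⟨z', h0, h1, u, by omega, fun i hi => hact i (by omega)⟩
      · exact Or.inr ⟨k, by omega, hkill⟩
    · -- `p` applied to the shift maps `s` to a sequence annihilated by `X - z`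
      left
      have hgeom : ∀ i, j₀ + i + q.natDegree ≤ j₁ + 1 →
          act p s (j₀ + i) = act p s j₀ * z ^ i := by
        intro i
        induction i with
        | zero => intro _; simp
        | succ i ihi =>
          intro hi
          have h1 := h (j₀ + i) (by omega) (by omega)
          rw [hp, act_mul, act_apply _ _ (N := 2) (by rw [natDegree_X_sub_C]; omega),
            sum_range_succ, sum_range_one] at h1
          simp only [coeff_sub, coeff_X_zero, coeff_C_zero, coeff_X_one, coeff_C_succ,
            add_zero] at h1
          rw [ihi (by omega)] at h1
          rw [← add_assoc, pow_succ]
          linear_combination h1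
      have hne : act p s j₀ ≠ 0 := by
        intro h0
        refine hpk fun j hj0 hj1 => ?_
        obtain ⟨i, rfl⟩ := Nat.exists_eq_add_of_le hj0
        rw [hgeom i (by omega), h0, zero_mul]
      refine ⟨z, hz0, hz1, C (act p s j₀)⁻¹ * p, ?_, fun i hi => ?_⟩
      · rw [natDegree_C_mul (inv_ne_zero hne)]; omega
      · have hC : act (C (act p s j₀)⁻¹ * p) s (j₀ + i)
            = (act p s j₀)⁻¹ * act p s (j₀ + i) := by
          rw [act_mul, act, aeval_C]; rfl
        rw [hC, hgeom i (by omega), inv_mul_cancel_left₀ hne]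
  · right
    push Not at hroot
    have hcard : Multiset.card q.roots = q.natDegree :=
      splits_iff_card_roots.mp (IsAlgClosed.splits q)
    have hrep : q.roots = Multiset.replicate q.natDegree 1 := by
      rw [Multiset.eq_replicate]; exact ⟨hcard, hroot⟩
    have hprod := C_leadingCoeff_mul_prod_multiset_X_sub_C hcard
    rw [hrep, Multiset.map_replicate, Multiset.prod_replicate, C_1] at hprod
    have hlc : q.leadingCoeff ≠ 0 := leadingCoeff_ne_zero.mpr hq0
    refine ⟨q.natDegree, hN.le, fun j hj0 hj1 => ?_⟩
    have hnd : ((X - 1 : K[X]) ^ q.natDegree).natDegree = q.natDegree := by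
      rw [natDegree_pow, ← C_1, natDegree_X_sub_C, mul_one]
    rw [hnd] at hj1
    have h1 := h j hj0 hj1
    have h2 : act q s j = q.leadingCoeff * act ((X - 1) ^ q.natDegree) s j := by
      conv_lhs => rw [← hprod, act_mul, act, aeval_C]
      rfl
    rw [h2] at h1
    exact (mul_eq_zero.mp h1).resolve_left hlc

lemma natDegree_X_sub_one_pow {R : Type*} [CommRing R] [Nontrivial R] (k : ℕ) :
    ((X - 1 : R[X]) ^ k).natDegree = k := by
  rw [← C_1, (monic_X_sub_C (1 : R)).natDegree_pow, natDegree_X_sub_C, mul_one]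

/-- In characteristic `p`, a sequence annihilated by `(X - 1) ^ k` has period the first power of
`p` that is at least `k`, because `(X - 1) ^ (p ^ e) = X ^ (p ^ e) - 1`. -/
lemma Kills.exists_period {p : ℕ} (hp : p.Prime) [CharP K p] {s : ℕ → K} {j₀ j₁ k : ℕ}
    (h : Kills ((X - 1) ^ k) s j₀ j₁) :
    ∃ e, p ^ e ≤ p * k + 1 ∧ ∀ j, j₀ ≤ j → j + p ^ e ≤ j₁ → s j = s (j + p ^ e) := by
  have : Fact p.Prime := ⟨hp⟩
  have hle : k ≤ p ^ Nat.clog p k := Nat.le_pow_clog hp.one_lt k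
  refine ⟨Nat.clog p k, ?_, fun j hj0 hj1 => ?_⟩
  · by_cases hk : 1 < k
    · have h1 := Nat.pow_pred_clog_lt_self hp.one_lt hk
      have h2 : 0 < Nat.clog p k := Nat.clog_pos hp.one_lt hk
      obtain ⟨m, hm⟩ := Nat.exists_eq_succ_of_ne_zero h2.ne'
      rw [hm] at h1 ⊢
      simp only [Nat.pred_succ, Nat.succ_eq_add_one] at h1 ⊢
      rw [pow_succ']
      exact (Nat.mul_le_mul_left p h1.le).trans (Nat.le_succ _)
    · rw [Nat.clog_of_right_le_one (by omega), pow_zero]; omega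
  · have hX : (X - 1 : K[X]) ≠ 0 := by rw [← C_1]; exact X_sub_C_ne_zero 1
    have h1 := h.mul_left (pow_ne_zero (p ^ Nat.clog p k - k) hX) (pow_ne_zero k hX)
    rw [← pow_add, Nat.sub_add_cancel hle] at h1
    have h2 := h1 j hj0 (by rw [natDegree_X_sub_one_pow]; exact hj1)
    rw [sub_pow_char_pow, one_pow, act_X_pow_sub_one, sub_eq_zero] at h2
    exact h2.symm

lemma bitVal_injective : Function.Injective (bitVal K) := by
  intro a b h
  cases a <;> cases b <;> simp_all [bitVal]

/-- In characteristic zero, the recurrence `(X - 1) ^ k` for a sequence of bits can be reduced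
modulo every prime. -/
lemma Kills.reduce [CharZero K] {L : Type*} [Field L] {σ : ℕ → Bool} {j₀ j₁ k : ℕ}
    (h : Kills ((X - 1) ^ k) (fun i => bitVal K (σ i)) j₀ j₁) :
    Kills ((X - 1) ^ k) (fun i => bitVal L (σ i)) j₀ j₁ := by
  intro j hj0 hj1
  rw [natDegree_X_sub_one_pow] at hj1
  have h1 := h j hj0 (by rw [natDegree_X_sub_one_pow]; exact hj1)
  have key : ∀ (F : Type _) [Field F], act ((X - 1) ^ k) (fun i => bitVal F (σ i)) j
      = Int.castRingHom F (act ((X - 1) ^ k) (fun i => if σ i = true then (1 : ℤ) else 0) j) := by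
    intro F _
    rw [← act_map]
    congr 1
    · simp
    · funext i; cases σ i <;> simp [bitVal]
  have key' : act ((X - 1) ^ k) (fun i => bitVal L (σ i)) j
      = Int.castRingHom L (act ((X - 1) ^ k) (fun i => if σ i = true then (1 : ℤ) else 0) j) := by
    rw [← act_map]
    congr 1
    · simp
    · funext i; cases σ i <;> simp [bitVal]
  rw [key K] at h1
  rw [key']
  have h2 : (act ((X - 1) ^ k) (fun i => if σ i = true then (1 : ℤ) else 0) j : ℤ) = 0 := by
    have h3 : ((act ((X - 1) ^ k) (fun i => if σ i = true then (1 : ℤ) else 0) j : ℤ) : K) = 0 := h1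
    exact_mod_cast h3
  rw [h2, map_zero]

/-- The theorem of Fine and Wilf: two periods `x`, `y` of a word of length at least `x + y` have
their greatest common divisor as a period. -/
lemma period_gcd {α : Type*} {σ : ℕ → α} {j₀ j₁ : ℕ} {x y : ℕ} (hxy : j₀ + x + y ≤ j₁ + 1)
    (hx : ∀ j, j₀ ≤ j → j + x ≤ j₁ → σ j = σ (j + x))
    (hy : ∀ j, j₀ ≤ j → j + y ≤ j₁ → σ j = σ (j + y)) :
    ∀ j, j₀ ≤ j → j + x.gcd y ≤ j₁ → σ j = σ (j + x.gcd y) := by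
  induction hN : x + y using Nat.strong_induction_on generalizing x y with
  | _ N ih =>
  wlog hle : x ≤ y generalizing x y
  · rw [Nat.gcd_comm]
    exact this (by omega) hy hx (by omega) (by omega)
  rcases Nat.eq_zero_or_pos x with rfl | hx0
  · simpa using hy
  · have hg : x.gcd y = x.gcd (y - x) := by
      conv_lhs => rw [show y = (y - x) + x by omega]
      simp
    rw [hg]
    refine ih (x + (y - x)) (by omega) (by omega) hx ?_ rfl
    intro j hj0 hj1
    by_cases hjy : j + y ≤ j₁
    · rw [hy j hj0 hjy, hx (j + (y - x)) (by omega) (by omega)]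
      congr 1; omega
    · obtain ⟨i, rfl⟩ := Nat.exists_eq_add_of_le (show x ≤ j by omega)
      have h1 := hx i (by omega) (by omega)
      have h2 := hy i (by omega) (by omega)
      rw [show x + i = i + x by omega, ← h1, h2]
      congr 1; omega

/-- If the windows of length `r` do not span, then a nonzero linear functional vanishes on all of
them, which is a recurrence of order less than `r`. -/
lemma exists_recurrence_of_not_windowsSpan {s : ℕ → K} {J : Finset ℕ} {r : ℕ}
    (h : ¬ WindowsSpan s J r) :
    ∃ q : K[X], q ≠ 0 ∧ q.natDegree < r ∧ ∀ j ∈ J, act q s j = 0 := by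
  classical
  let W : Submodule K (Fin r → K) :=
    Submodule.span K ((J.image fun j (i : Fin r) => s (i + j) : Finset (Fin r → K)) : Set _)
  have hW : W < ⊤ := by
    rw [lt_top_iff_ne_top]
    intro htop
    refine h fun t => ?_
    have ht : (fun i : Fin r => t i) ∈ W := by rw [htop]; trivial
    rw [show W = Submodule.span K ((fun j (i : Fin r) => s (i + j)) '' (J : Set ℕ)) by
      simp [W]] at ht
    obtain ⟨c, hc⟩ := (Submodule.mem_span_image_finset_iff_exists_fun K).mp ht
    refine ⟨fun j => if h : j ∈ J then c ⟨j, h⟩ else 0, fun i hi => ?_⟩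
    rw [← congrFun hc ⟨i, hi⟩, ← sum_coe_sort J, Finset.sum_apply]
    exact sum_congr rfl fun j _ => by simp
  obtain ⟨φ, hφ0, hφ⟩ := Submodule.exists_le_ker_of_lt_top W hW
  let v : Fin r → K := fun i => φ (Pi.single i 1)
  have hφv : ∀ t : Fin r → K, φ t = ∑ i, v i * t i := by
    intro t
    conv_lhs => rw [pi_eq_sum_univ' t]
    rw [map_sum]
    refine sum_congr rfl fun i _ => ?_
    rw [map_smul, smul_eq_mul, mul_comm]
  let q : K[X] := ∑ i : Fin r, monomial i (v i)
  have hcoeff : ∀ i : Fin r, q.coeff i = v i := by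
    intro i
    simp only [q, finsetSum_coeff, coeff_monomial]
    rw [sum_eq_single i]
    · simp
    · intro k _ hk; rw [if_neg]; exact fun hik => hk (Fin.ext hik)
    · simp
  have hr : 0 < r := by
    rcases Nat.eq_zero_or_pos r with rfl | hr
    · exact absurd (LinearMap.ext fun t => by rw [hφv]; simp) hφ0
    · exact hr
  have hdeg : q.natDegree < r := by
    refine lt_of_le_of_lt (natDegree_sum_le_of_forall_le (n := r - 1) _ _ fun i _ => ?_) (by omega)
    exact (natDegree_monomial_le _).trans (by have := i.2; omega)
  refine ⟨q, ?_, hdeg, fun j hj => ?_⟩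
  · intro hq
    refine hφ0 (LinearMap.ext fun t => ?_)
    rw [hφv, LinearMap.zero_apply]
    refine sum_eq_zero fun i _ => ?_
    rw [← hcoeff i, hq, coeff_zero, zero_mul]
  · rw [act_apply q s hdeg, ← Fin.sum_univ_eq_sum_range fun i => q.coeff i * s (j + i)]
    have hmem : (fun i : Fin r => s (i + j)) ∈ W :=
      Submodule.subset_span (by simpa using ⟨j, hj, rfl⟩)
    have h0 : φ (fun i : Fin r => s (i + j)) = 0 := hφ hmem
    rw [hφv] at h0
    rw [← h0]
    exact sum_congr rfl fun i _ => by rw [hcoeff, add_comm]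

/-- Discarding the factor `X ^ a` from the characteristic polynomial of a recurrence. -/
lemma exists_kills_of_not_windowsSpan {s : ℕ → K} {A B r : ℕ}
    (h : ¬ WindowsSpan s (Icc A B) r) :
    ∃ q : K[X], q.coeff 0 ≠ 0 ∧ q.natDegree < r ∧ Kills q s (A + r - 1) B := by
  obtain ⟨q, hq0, hdeg, hq⟩ := exists_recurrence_of_not_windowsSpan h
  obtain ⟨p, hp, hXp⟩ := exists_eq_pow_rootMultiplicity_mul_and_not_dvd q hq0 0
  set a := q.rootMultiplicity 0
  rw [C_0, sub_zero] at hp hXp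
  have hp0 : p ≠ 0 := by rintro rfl; exact hq0 (by rw [hp, mul_zero])
  have hdegs : q.natDegree = a + p.natDegree := by
    rw [hp, natDegree_mul (pow_ne_zero _ X_ne_zero) hp0, natDegree_X_pow]
  refine ⟨p, fun h0 => hXp (X_dvd_iff.mpr h0), by omega, fun j hj0 hj1 => ?_⟩
  have h1 := hq (j - a) (mem_Icc.mpr ⟨by omega, by omega⟩)
  rw [hp, act_mul, act, map_pow, aeval_X, shift_pow_apply, show j - a + a = j by omega] at h1
  exact h1

end Recurrences

/-! ### The periodic part -/

section Structure

variable {K : Type*} [Field K] {n d : ℕ} {ε : ℝ} {f g h : BoolFun n}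

lemma exists_ne_zero_ne_one [IsAlgClosed K] : ∃ z : K, z ≠ 0 ∧ z ≠ 1 := by
  classical
  have : Infinite K := IsAlgClosed.instInfinite
  obtain ⟨z, hz⟩ := Infinite.exists_notMem_finset ({0, 1} : Finset K)
  simp only [mem_insert, mem_singleton, not_or] at hz
  exact ⟨z, hz.1, hz.2⟩

/-- Either `f` has large probabilistic degree, or its spectrum on the middle third satisfies the
recurrence `(X - 1) ^ k` with `k` small: take for `r` the least length for which the windows of the
spectrum do not span, apply `le_or_le_of_windowsSpan` to the windows of length `r - 1`, and apply
`Kills.eigen_or_unipotent` to a recurrence of order less than `r`. -/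
lemma ProbApprox.le_or_kills [IsAlgClosed K] (h : ProbApprox K ε d f) (hf : f.IsSymmetric)
    (hd : 1 ≤ d) (hn : 2 ≤ n) (hε0 : 1 / 2 ^ n ≤ ε) (hε : ε ≤ 1 / 3) {P : ℕ} (hP : 3 ≤ P) :
    n * Real.log (1 / ε) ≤
        (1344 * P * (Nat.log 2 n + 1 : ℕ) * (201 * (Nat.log 2 n + 1) * d : ℕ)) ^ 2 ∨
      ∃ k, k < n / (24 * P) ∧
        (k : ℝ) ≤ 28 * (Nat.log 2 n + 1 : ℕ) * (201 * (Nat.log 2 n + 1) * d : ℕ) ∧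
        Kills ((X - 1) ^ k) (fun i => bitVal K (f.spec i)) ((n + 2) / 3) (2 * n / 3) := by
  have hεpos : 0 < ε := lt_of_lt_of_le (by positivity) hε0
  have hl1 := one_le_log_one_div hεpos hε
  have hln := log_one_div_le hε0
  obtain ⟨z, hz0, hz1⟩ := exists_ne_zero_ne_one (K := K)
  set A := n / 8 with hA
  have key := fun r (hr : r ≤ n / 72) (hn72 : 72 ≤ n) hspan =>
    h.le_or_le_of_windowsSpan hf hd hε0 hε hz0 hz1 (A := A) (B := n + 1 - A - r) (r := r) hspan
      (by omega) (by omega) (by omega) (by omega)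
  set lam := Nat.log 2 n + 1 with hlam
  set M := 201 * lam * d with hM
  set l := Real.log (1 / ε) with hl
  set s : ℕ → K := fun i => bitVal K (f.spec i) with hs
  have hlam1 : (1 : ℝ) ≤ lam := by exact_mod_cast (show 1 ≤ lam by omega)
  have hM1 : (1 : ℝ) ≤ M := by
    have : 0 < 201 * lam * d := Nat.mul_pos (by omega) hd
    exact_mod_cast this
  have hP3 : (3 : ℝ) ≤ P := by exact_mod_cast hP
  have hlM : (M : ℝ) ≤ lam * M := le_mul_of_one_le_left (by linarith) hlam1
  have hPlM : (P : ℝ) * M ≤ P * (lam * M) := by gcongr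
  have hPM : (P : ℝ) ≤ P * M := le_mul_of_one_le_right (by linarith) hM1
  have h3M : 3 * (M : ℝ) ≤ P * M := by gcongr
  -- it suffices to bound `n` linearly
  have hlin : (n : ℝ) ≤ 1344 * P * lam * M → n * l ≤ (1344 * P * lam * M : ℝ) ^ 2 := by
    intro hnl
    calc n * l ≤ n * n := by gcongr
      _ = (n : ℝ) ^ 2 := by ring
      _ ≤ _ := pow_le_pow_left₀ (by positivity) hnl 2
  have hquad : n * l ≤ 4096 * (M : ℝ) ^ 2 → n * l ≤ (1344 * P * lam * M : ℝ) ^ 2 := by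
    intro hnl
    calc n * l ≤ (64 * (M : ℝ)) ^ 2 := by linarith
      _ ≤ _ := pow_le_pow_left₀ (by positivity) (by linarith) 2
  by_cases hsmall : n < 24 * P
  · left
    have : (n : ℝ) < 24 * P := by exact_mod_cast hsmall
    exact hlin (by linarith)
  push Not at hsmall
  have hr₀72 : n / (24 * P) ≤ n / 72 := Nat.div_le_div_left (by omega) (by omega)
  by_cases hfull : WindowsSpan s (Icc A (n + 1 - A - n / (24 * P))) (n / (24 * P))
  · left
    rcases key _ hr₀72 (by omega) hfull with h1 | h1
    · refine hlin ?_
      have h2 : n ≤ 48 * P * (n / (24 * P)) := by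
        have h3 : 1 ≤ n / (24 * P) := (Nat.one_le_div_iff (by omega)).mpr hsmall
        have h4 := Nat.lt_div_mul_add (a := n) (b := 24 * P) (by omega)
        have h5 : 24 * P ≤ n / (24 * P) * (24 * P) := Nat.le_mul_of_pos_left _ h3
        have h6 : 48 * P * (n / (24 * P)) = 2 * (n / (24 * P) * (24 * P)) := by ring
        omega
      have h2R : (n : ℝ) ≤ 48 * P * (n / (24 * P) : ℕ) := by exact_mod_cast h2
      calc (n : ℝ) ≤ 48 * P * (n / (24 * P) : ℕ) := h2R
        _ ≤ 48 * P * (28 * lam * M) := by gcongr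
        _ = _ := by ring
    · exact hquad h1
  -- the least length at which the windows do not span
  classical
  have hex : ∃ r, ¬ WindowsSpan s (Icc A (n + 1 - A - r)) r := ⟨_, hfull⟩
  obtain ⟨r, hr, hrmin⟩ : ∃ r, (¬ WindowsSpan s (Icc A (n + 1 - A - r)) r) ∧
      ∀ r' < r, WindowsSpan s (Icc A (n + 1 - A - r')) r' :=
    ⟨Nat.find hex, Nat.find_spec hex, fun r' hr' => not_not.mp (Nat.find_min hex hr')⟩
  have hrle : r ≤ n / (24 * P) := by
    by_contra hlt
    exact hfull (hrmin _ (not_le.mp hlt))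
  have hr1 : 1 ≤ r := by
    rcases Nat.eq_zero_or_pos r with rfl | hpos
    · exact absurd (fun t => ⟨0, by simp⟩) hr
    · exact hpos
  obtain ⟨q, hqc, hqdeg, hqk⟩ := exists_kills_of_not_windowsSpan hr
  have hqk' : Kills q s ((n + 2) / 3) (2 * n / 3) :=
    fun j hj0 hj1 => hqk j (by omega) (by omega)
  rcases hqk'.eigen_or_unipotent hqc with ⟨y, hy0, hy1, u, hu, hact⟩ | ⟨k, hk, hkill⟩
  · -- the geometric sequence is long enough for `2w ≈ n / 12` variables
    left
    obtain ⟨w, hw⟩ : ∃ w, w = n / 24 := ⟨_, rfl⟩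
    have hsum : ∀ i, i ≤ 2 * w → ∑ j ∈ (range (u.natDegree + 1)).image fun t => (n + 2) / 3 + t,
        u.coeff (j - (n + 2) / 3) * bitVal K (f.spec (i + j)) = y ^ i := by
      intro i hi
      rw [sum_image (fun _ _ _ _ hab => by simpa using hab),
        ← hact i (by omega), act_apply u s (Nat.lt_succ_self _)]
      refine sum_congr rfl fun t _ => ?_
      rw [Nat.add_sub_cancel_left, hs]
      congr 3; ring
    have hres : w ≤ 4 * M ∨ w * l ≤ 4 * (M : ℝ) ^ 2 :=
      h.smolensky hf hd hεpos hε (by omega) (by omega) hy0 hy1 _ (fun j hj => by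
        obtain ⟨t, ht, rfl⟩ := mem_image.mp hj
        rw [mem_range] at ht
        omega) (fun j => u.coeff (j - (n + 2) / 3)) (2 * w + 1)
        (fun i _ hi => hsum i (by omega)) (Or.inl (by omega))
    have hwn : (n : ℝ) ≤ 48 * w := by exact_mod_cast (show n ≤ 48 * w by omega)
    rcases hres with h1 | h1
    · have : (w : ℝ) ≤ 4 * M := by exact_mod_cast h1
      exact hlin (by linarith)
    · have h2 : n * l ≤ 48 * w * l := by gcongr
      have h3 : (0 : ℝ) ≤ (M : ℝ) ^ 2 := by positivity
      exact hquad (by linarith)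
  · rcases key (r - 1) (by omega) (by omega) (hrmin (r - 1) (by omega)) with h1 | h1
    · right
      refine ⟨k, by omega, le_trans ?_ h1, hkill⟩
      exact_mod_cast (show k ≤ r - 1 by omega)
    · exact Or.inl (hquad h1)

lemma weight_threshold {i : ℕ} (hi : i ≤ n) :
    BoolFun.weight (fun j : Fin n => decide (j.val < i)) = i := by
  change (univ.filter fun j : Fin n => decide (j.val < i) = true).card = i
  simp only [decide_eq_true_eq]
  rw [Fin.card_filter_val_lt]
  omega

lemma per_spec (g : BoolFun n) :
    0 < g.per ∧ ∀ i, i + g.per ≤ n → g.spec i = g.spec (i + g.per) :=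
  Nat.sInf_mem (s := {b : ℕ | 0 < b ∧ ∀ i : ℕ, i + b ≤ n → g.spec i = g.spec (i + b)})
    ⟨n + 1, Nat.succ_pos n, fun i hi => by omega⟩

/-- The periodic part of a standard decomposition has the least period of `Spec f` on the middle
third, because a periodic word extends to all weights with the same period. -/
lemma per_le_of_period (hs : BoolFun.IsStandardDecomposition f g h) {x : ℕ} (hx : 1 ≤ x)
    (hper : ∀ j, (n + 2) / 3 ≤ j → j + x ≤ 2 * n / 3 → f.spec j = f.spec (j + x)) :
    g.per ≤ x := by
  set j₀ := (n + 2) / 3 with hj₀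
  have hj₀x : j₀ ≤ x * j₀ := Nat.le_mul_of_pos_left _ hx
  -- the summand `x * j₀` keeps the natural number subtraction from truncating
  let σ : ℕ → Bool := fun i => f.spec (j₀ + (i + x * j₀ - j₀) % x)
  have hσ : ∀ i, σ i = σ (i + x) := by
    intro i
    simp only [σ]
    rw [show i + x + x * j₀ - j₀ = (i + x * j₀ - j₀) + x by omega, Nat.add_mod_right]
  let f' : BoolFun n := fun a => σ (BoolFun.weight a)
  have hspec : ∀ i, i ≤ n → f'.spec i = σ i := by
    intro i hi
    simp only [f', BoolFun.spec]
    rw [weight_threshold hi]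
  have hf' : f'.IsSymmetric := fun a b hab => by simp only [f', hab]
  have hmod : ∀ t, j₀ + t ≤ 2 * n / 3 → f.spec (j₀ + t) = f.spec (j₀ + t % x) := by
    intro t
    induction t using Nat.strong_induction_on with
    | _ t ih =>
    intro ht
    by_cases htx : t < x
    · rw [Nat.mod_eq_of_lt htx]
    · push Not at htx
      have h1 := hper (j₀ + (t - x)) (by omega) (by omega)
      rw [show j₀ + (t - x) + x = j₀ + t by omega] at h1
      rw [← h1, ih (t - x) (by omega) (by omega), Nat.mod_eq_sub_mod htx]
  refine (hs.per_le f' hf' fun i hi1 hi2 => ?_).trans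
    (Nat.sInf_le ⟨hx, fun i hi => ?_⟩)
  · rw [hspec i (by omega)]
    obtain ⟨t, rfl⟩ := Nat.exists_eq_add_of_le (show j₀ ≤ i by omega)
    rw [hmod t (by omega)]
    simp only [σ]
    rw [show j₀ + t + x * j₀ - j₀ = t + x * j₀ by omega, Nat.add_mul_mod_self_left]
  · rw [hspec i (by omega), hspec (i + x) hi]
    exact hσ i

lemma period_of_standard (hs : BoolFun.IsStandardDecomposition f g h) :
    ∀ j, (n + 2) / 3 ≤ j → j + g.per ≤ 2 * n / 3 → f.spec j = f.spec (j + g.per) := by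
  intro j hj0 hj1
  rw [← hs.agree j (by omega) (by omega), ← hs.agree (j + g.per) (by omega) (by omega)]
  exact (per_spec g).2 j (by omega)

/-- The lower bound when the period is not a power of the characteristic. -/
lemma ProbApprox.of_not_isPowerOf {p : ℕ} [CharP K p] (hpp : p.Prime ∨ p = 0)
    (hs : BoolFun.IsStandardDecomposition f g h) (hK : ProbApprox K ε d f) (hd : 1 ≤ d)
    (hn : 2 ≤ n) (hε0 : 1 / 2 ^ n ≤ ε) (hε : ε ≤ 1 / 3) (h1 : 1 < g.per)
    (hpow : ¬ IsPowerOf p g.per) :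
    n * Real.log (1 / ε) ≤ (1344 * (p + 3 : ℕ) * (Nat.log 2 n + 1 : ℕ) *
      (201 * (Nat.log 2 n + 1) * d : ℕ)) ^ 2 := by
  have : CharP (AlgebraicClosure K) p :=
    charP_of_injective_algebraMap (algebraMap K (AlgebraicClosure K)).injective p
  refine ((hK.baseChange (AlgebraicClosure K)).le_or_kills hs.symm hd hn hε0 hε
    (P := p + 3) (by omega)).resolve_right ?_
  rintro ⟨k, hk, -, hkill⟩
  have hn24 : (k + 1) * (24 * (p + 3)) ≤ n :=
    (Nat.mul_le_mul_right _ hk).trans (Nat.div_mul_le_self n _)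
  have hpk : 24 * (p * k) + 72 * k + 24 * p + 72 ≤ n := by
    have : (k + 1) * (24 * (p + 3)) = 24 * (p * k) + 72 * k + 24 * p + 72 := by ring
    omega
  rcases hpp with hp | rfl
  · obtain ⟨e, he, hper⟩ := hkill.exists_period hp
    have hper' : ∀ j, (n + 2) / 3 ≤ j → j + p ^ e ≤ 2 * n / 3 →
        f.spec j = f.spec (j + p ^ e) := fun j hj0 hj1 => bitVal_injective (hper j hj0 hj1)
    have hble := per_le_of_period hs (Nat.pow_pos hp.pos) hper'
    have hgcd := period_gcd (by omega) (period_of_standard hs) hper'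
    have hpos : 0 < g.per.gcd (p ^ e) := Nat.gcd_pos_of_pos_left _ (by omega)
    -- the greatest common divisor is again a period of the middle third, so it is `g.per`
    have hble' := per_le_of_period hs hpos hgcd
    have hdvd : g.per ∣ p ^ e := by
      have := Nat.le_antisymm (Nat.gcd_le_left (p ^ e) (by omega)) hble'
      rw [← this]; exact Nat.gcd_dvd_right _ _
    obtain ⟨i, -, hi⟩ := (Nat.dvd_prime_pow hp).mp hdvd
    refine hpow ⟨i, ?_, hi⟩
    rcases Nat.eq_zero_or_pos i with rfl | hi0
    · rw [pow_zero] at hi; omega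
    · exact hi0
  · -- in characteristic zero, the middle of the spectrum has a power of `2` and one of `3` as period
    have : CharZero (AlgebraicClosure K) := CharP.charP_to_charZero _
    have : Fact (Nat.Prime 2) := ⟨Nat.prime_two⟩
    have : Fact (Nat.Prime 3) := ⟨Nat.prime_three⟩
    obtain ⟨a, ha, hper2⟩ := (hkill.reduce (L := ZMod 2)).exists_period Nat.prime_two
    obtain ⟨c, hc, hper3⟩ := (hkill.reduce (L := ZMod 3)).exists_period Nat.prime_three
    have hgcd := period_gcd (σ := f.spec) (x := 2 ^ a) (y := 3 ^ c) (by omega)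
      (fun j hj0 hj1 => bitVal_injective (hper2 j hj0 hj1))
      (fun j hj0 hj1 => bitVal_injective (hper3 j hj0 hj1))
    rw [Nat.Coprime.pow a c (by norm_num)] at hgcd
    have := per_le_of_period hs le_rfl hgcd
    omega

/-- The lower bound when the period is a power of the characteristic. -/
lemma ProbApprox.of_isPowerOf {p : ℕ} [CharP K p] (hp : p.Prime)
    (hs : BoolFun.IsStandardDecomposition f g h) (hK : ProbApprox K ε d f) (hd : 1 ≤ d)
    (hn : 2 ≤ n) (hε0 : 1 / 2 ^ n ≤ ε) (hε : ε ≤ 1 / 3) :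
    n * Real.log (1 / ε) ≤ (1344 * (p + 3 : ℕ) * (Nat.log 2 n + 1 : ℕ) *
        (201 * (Nat.log 2 n + 1) * d : ℕ)) ^ 2 ∨
      (g.per : ℝ) ≤ p * (28 * (Nat.log 2 n + 1 : ℕ) * (201 * (Nat.log 2 n + 1) * d : ℕ)) + 1 := by
  have : CharP (AlgebraicClosure K) p :=
    charP_of_injective_algebraMap (algebraMap K (AlgebraicClosure K)).injective p
  refine ((hK.baseChange (AlgebraicClosure K)).le_or_kills hs.symm hd hn hε0 hε
    (P := p + 3) (by omega)).imp_right ?_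
  rintro ⟨k, -, hk, hkill⟩
  obtain ⟨e, he, hper⟩ := hkill.exists_period hp
  have hble := per_le_of_period hs (Nat.pow_pos hp.pos)
    fun j hj0 hj1 => bitVal_injective (hper j hj0 hj1)
  have hb : (g.per : ℝ) ≤ p * k + 1 := by exact_mod_cast hble.trans he
  have : (p : ℝ) * k ≤ p * (28 * (Nat.log 2 n + 1 : ℕ) * (201 * (Nat.log 2 n + 1) * d : ℕ)) := by
    gcongr
  linarith

end Structure

/-! ### The bounded part -/

section Bounded

variable {K : Type*} [Field K] {n d : ℕ} {ε : ℝ} {f g h : BoolFun n}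

/-- A nontrivial recurrence propagates a run of zeros to the whole interval. -/
lemma Kills.eq_zero {q : K[X]} (hq : q.coeff 0 ≠ 0) {s : ℕ → K} {a b x y : ℕ}
    (h : Kills q s a b) (hax : a ≤ x) (hyb : y ≤ b) (hxy : x + q.natDegree ≤ y + 1)
    (hzero : ∀ i, x ≤ i → i ≤ y → s i = 0) : ∀ i, a ≤ i → i ≤ b → s i = 0 := by
  have hq0 : q ≠ 0 := fun h0 => hq (by simp [h0])
  have hlc : q.coeff q.natDegree ≠ 0 := leadingCoeff_ne_zero.mpr hq0
  have hright : ∀ i, x ≤ i → i ≤ b → s i = 0 := by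
    intro i
    induction i using Nat.strong_induction_on with
    | _ i ih =>
    intro hi0 hi1
    by_cases hiy : i ≤ y
    · exact hzero i hi0 hiy
    · have h1 := h (i - q.natDegree) (by omega) (by omega)
      rw [act_apply q s (Nat.lt_succ_self _), sum_range_succ, sum_eq_zero, zero_add,
        show i - q.natDegree + q.natDegree = i by omega] at h1
      · exact (mul_eq_zero.mp h1).resolve_left hlc
      · intro t ht
        rw [mem_range] at ht
        rw [ih _ (by omega) (by omega) (by omega), mul_zero]
  have hleft : ∀ t i, x ≤ i + t → a ≤ i → i ≤ b → s i = 0 := by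
    intro t
    induction t with
    | zero => intro i hi _ hi1; exact hright i (by omega) hi1
    | succ t ih =>
      intro i hi hi0 hi1
      by_cases hix : x ≤ i
      · exact hright i hix hi1
      · have h1 := h i hi0 (by omega)
        rw [act_apply q s (Nat.lt_succ_self _), sum_range_succ', sum_eq_zero, zero_add,
          add_zero] at h1
        · exact (mul_eq_zero.mp h1).resolve_left hq
        · intro t' ht'
          rw [mem_range] at ht'
          rw [ih _ (by omega) (by omega) (by omega), mul_zero]
  exact fun i => hleft x i (by omega)

lemma isBounded_third (hmid : ∀ i, n ≤ 3 * i → 3 * i ≤ 2 * n → h.spec i = false) :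
    h.IsBounded ((n + 2) / 3) :=
  ⟨false, fun i hi0 hi1 => hmid i (by omega) (by omega)⟩

lemma bd_le_third (hmid : ∀ i, n ≤ 3 * i → 3 * i ≤ 2 * n → h.spec i = false) :
    h.bd ≤ (n + 2) / 3 := Nat.sInf_le (isBounded_third hmid)

lemma spec_eq_false_of_bd_le (hn : 2 ≤ n)
    (hmid : ∀ i, n ≤ 3 * i → 3 * i ≤ 2 * n → h.spec i = false) :
    ∀ i, h.bd ≤ i → i + h.bd ≤ n → h.spec i = false := by
  have hle := bd_le_third hmid
  obtain ⟨v, hv⟩ : h.IsBounded h.bd :=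
    Nat.sInf_mem (s := {k : ℕ | h.IsBounded k}) ⟨_, isBounded_third hmid⟩
  have h1 := hv ((n + 2) / 3) (by omega) (by omega)
  rw [hmid _ (by omega) (by omega)] at h1
  rwa [h1]

lemma exists_spec_eq_true (hB : 1 ≤ h.bd) :
    ∃ i, h.bd ≤ i + 1 ∧ i + h.bd ≤ n + 1 ∧ h.spec i = true := by
  by_contra! hc
  have : h.IsBounded (h.bd - 1) :=
    ⟨false, fun i hi0 hi1 => by simpa using hc i (by omega) (by omega)⟩
  have := Nat.sInf_le (s := {k : ℕ | h.IsBounded k}) this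
  change h.bd ≤ _ at this
  omega

lemma weight_eq_zero_iff {m : ℕ} (a : Fin m → Bool) :
    BoolFun.weight a = 0 ↔ a = fun _ => false := by
  rw [BoolFun.weight, card_eq_zero, filter_eq_empty_iff, funext_iff]
  simp

lemma weight_eq_iff {m : ℕ} (a : Fin m → Bool) :
    BoolFun.weight a = m ↔ a = fun _ => true := by
  have : BoolFun.weight a = m ↔ #{i | a i = true} = #(univ : Finset (Fin m)) := by
    rw [card_univ, Fintype.card_fin]; rfl
  rw [this, card_filter_eq_iff, funext_iff]
  simp

/-- A function that takes the value `1` exactly once on a subcube with more than `d` free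
variables is not of degree `d`, so every member of a probabilistic polynomial of degree `d` errs
somewhere on the subcube. -/
lemma ProbApprox.one_le_of_unique (hK : ProbApprox K ε d h) (j : ℕ) (b : Fin (d + 1) → Bool)
    (hb : ∀ a, h (extend n j a) = true ↔ a = b) : 1 ≤ 2 ^ (d + 1) * ε := by
  classical
  obtain ⟨Ω, _, w, P, h0, h1, h2, h3⟩ := hK
  have hbad : ∀ ω, ∃ a : Fin (d + 1) → Bool,
      P ω (extend n j a) ≠ bitVal K (h (extend n j a)) := by
    intro ω
    by_contra! hc
    have halt := alternating_sum_eq_zero (comp_extend_mem_lowDeg (m := d + 1) j (h2 ω))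
      (Nat.lt_succ_self d)
    rw [sum_eq_single b] at halt
    · rw [hc b, (hb b).mpr rfl, bitVal, if_pos rfl, mul_one] at halt
      exact pow_ne_zero _ (neg_ne_zero.mpr one_ne_zero) halt
    · intro a _ hab
      have : h (extend n j a) = false := by
        rw [← Bool.not_eq_true, hb a]; exact hab
      rw [hc a, this]
      simp [bitVal]
    · simp
  have hle : ∑ ω, w ω ≤ ∑ ω, ∑ a : Fin (d + 1) → Bool,
      (if P ω (extend n j a) = bitVal K (h (extend n j a)) then 0 else w ω) := by
    refine sum_le_sum fun ω _ => ?_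
    obtain ⟨a, ha⟩ := hbad ω
    refine le_trans (le_of_eq (if_neg ha).symm) (single_le_sum (f := fun a : Fin (d + 1) → Bool =>
      if P ω (extend n j a) = bitVal K (h (extend n j a)) then 0 else w ω)
      (fun a _ => ?_) (mem_univ a))
    split_ifs
    · exact le_rfl
    · exact h0 ω
  rw [h1, sum_comm] at hle
  refine hle.trans ?_
  calc ∑ a : Fin (d + 1) → Bool, ∑ ω,
      (if P ω (extend n j a) = bitVal K (h (extend n j a)) then 0 else w ω)
      ≤ ∑ a : Fin (d + 1) → Bool, ε := sum_le_sum fun a _ =>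
        (le_of_eq (sum_congr rfl fun ω _ => by congr)).trans (h3 (extend n j a))
    _ = 2 ^ (d + 1) * ε := by simp

lemma ProbApprox.log_le_of_bounded (hK : ProbApprox K ε d h) (hsym : h.IsSymmetric)
    (hmid : ∀ i, n ≤ 3 * i → 3 * i ≤ 2 * n → h.spec i = false) (hB : 1 ≤ h.bd)
    (hd : 1 ≤ d) (hn : 2 ≤ n) (hε0 : 1 / 2 ^ n ≤ ε) :
    Real.log (1 / ε) ≤ 7 * d := by
  have hεpos : 0 < ε := lt_of_lt_of_le (by positivity) hε0
  have hBle := bd_le_third hmid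
  have hfalse := spec_eq_false_of_bd_le hn hmid
  by_cases hdn : n < d + 2 * h.bd
  · have h1 : (n : ℝ) ≤ 7 * d := by exact_mod_cast (show n ≤ 7 * d by omega)
    exact (log_one_div_le hε0).trans h1
  push Not at hdn
  have hone : 1 ≤ 2 ^ (d + 1) * ε := by
    obtain ⟨i, hi0, hi1, hi⟩ := exists_spec_eq_true hB
    -- a one just outside `[B(h), n - B(h)]`; the subcube continues it by zeros of `Spec h`
    have hcase : i + 1 = h.bd ∨ i + h.bd = n + 1 := by
      by_contra! hc
      rw [hfalse i (by omega) (by omega)] at hi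
      exact Bool.false_ne_true hi
    rcases hcase with hcase | hcase
    · refine hK.one_le_of_unique i (fun _ => false) fun a => ?_
      have hwt := weight_le a
      rw [BoolFun.eq_spec_weight hsym, weight_extend (by omega), ← weight_eq_zero_iff]
      constructor
      · intro ha
        by_contra hne
        rw [hfalse _ (by omega) (by omega)] at ha
        exact Bool.false_ne_true ha
      · intro ha
        rw [ha, zero_add]; exact hi
    · refine hK.one_le_of_unique (i - (d + 1)) (fun _ => true) fun a => ?_
      have hwt := weight_le a
      rw [BoolFun.eq_spec_weight hsym, weight_extend (by omega), ← weight_eq_iff]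
      constructor
      · intro ha
        by_contra hne
        rw [hfalse _ (by omega) (by omega)] at ha
        exact Bool.false_ne_true ha
      · intro ha
        rw [ha, show d + 1 + (i - (d + 1)) = i by omega]; exact hi
  have h2 : 1 / ε ≤ 2 ^ (d + 1) := by rw [div_le_iff₀ hεpos]; exact hone
  have hdR : (1 : ℝ) ≤ d := by exact_mod_cast hd
  calc Real.log (1 / ε) ≤ Real.log (2 ^ (d + 1)) := Real.log_le_log (by positivity) h2
    _ = (d + 1) * Real.log 2 := by rw [Real.log_pow]; push_cast; ring
    _ ≤ (d + 1) * 1 := by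
        refine mul_le_mul_of_nonneg_left ?_ (by positivity)
        linarith [Real.log_two_lt_d9]
    _ ≤ 7 * d := by linarith

/-- The lower bound for a symmetric function that vanishes on the middle third. The windows of
length `B(h)` of its spectrum span: otherwise a recurrence of order less than `B(h)` would extend
the zeros in the middle beyond the interval `[B(h), n - B(h)]`. -/
lemma ProbApprox.of_bounded (hK : ProbApprox K ε d h) (hsym : h.IsSymmetric)
    (hmid : ∀ i, n ≤ 3 * i → 3 * i ≤ 2 * n → h.spec i = false) (hB : 1 ≤ h.bd)
    (hd : 1 ≤ d) (hn : 2 ≤ n) (hε0 : 1 / 2 ^ n ≤ ε) (hε : ε ≤ 1 / 3) :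
    √(h.bd * Real.log (1 / ε)) + Real.log (1 / ε)
      ≤ 20 * (201 * (Nat.log 2 n + 1) * d : ℕ) := by
  have hεpos : 0 < ε := lt_of_lt_of_le (by positivity) hε0
  have hl1 := one_le_log_one_div hεpos hε
  have hl7 := hK.log_le_of_bounded hsym hmid hB hd hn hε0
  have hBle := bd_le_third hmid
  obtain ⟨z, hz0, hz1⟩ := exists_ne_zero_ne_one (K := AlgebraicClosure K)
  have hspan : WindowsSpan (fun i => bitVal (AlgebraicClosure K) (h.spec i))
      (Icc 0 (n + 1 - h.bd)) h.bd := by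
    by_contra hns
    obtain ⟨q, hqc, hqdeg, hqk⟩ := exists_kills_of_not_windowsSpan hns
    have hzero := hqk.eq_zero hqc (x := (n + 2) / 3) (y := 2 * n / 3) (by omega) (by omega)
      (by omega) fun i hi0 hi1 => by rw [hmid i (by omega) (by omega)]; rfl
    obtain ⟨i, hi0, hi1, hi⟩ := exists_spec_eq_true hB
    have h1 := hzero i (by omega) (by omega)
    rw [hi, bitVal, if_pos rfl] at h1
    exact one_ne_zero h1
  have key := fun w hw hr hwn => (hK.baseChange (AlgebraicClosure K)).smolensky_of_windowsSpan
    hsym hd hεpos hε hz0 hz1 hspan hB (by omega) (w := w) hw (Or.inl hr) hwn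
  set M := 201 * (Nat.log 2 n + 1) * d with hM
  set l := Real.log (1 / ε) with hl
  have hdM : (d : ℝ) ≤ M := by
    have : d ≤ 201 * (Nat.log 2 n + 1) * d := Nat.le_mul_of_pos_left _ (by omega)
    exact_mod_cast this
  have hdR : (1 : ℝ) ≤ d := by exact_mod_cast hd
  have hlM : l ≤ 7 * M := by linarith
  have hBl : h.bd * l ≤ (13 * (M : ℝ)) ^ 2 := by
    by_cases hB3 : h.bd < 3
    · have h2 : (h.bd : ℝ) ≤ 3 := by exact_mod_cast hB3.le
      calc h.bd * l ≤ 3 * (7 * M) := by gcongr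
        _ ≤ (13 * (M : ℝ)) ^ 2 := by nlinarith
    · obtain ⟨w, hw⟩ : ∃ w, w = (h.bd - 1) / 2 := ⟨_, rfl⟩
      have hB6 : (h.bd : ℝ) ≤ 6 * w := by exact_mod_cast (show h.bd ≤ 6 * w by omega)
      rcases key w (by omega) (by omega) (by omega) with h1 | h1
      · have h2 : (w : ℝ) ≤ 4 * M := by exact_mod_cast h1
        calc h.bd * l ≤ (24 * M) * (7 * M) := by
              have : (h.bd : ℝ) ≤ 24 * M := by linarith
              gcongr
          _ ≤ (13 * (M : ℝ)) ^ 2 := by nlinarith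
      · calc h.bd * l ≤ 6 * w * l := by gcongr
          _ ≤ (13 * (M : ℝ)) ^ 2 := by nlinarith
  have hsqrt : √(h.bd * l) ≤ 13 * M := by
    rw [Real.sqrt_le_left (by positivity)]; exact hBl
  linarith

end Bounded

section PeriodicPolynomials

variable {K : Type*} [Field K] {n : ℕ} {g : BoolFun n}

lemma choose_weight_mem_lowDeg (k : ℕ) :
    (fun a : Fin n → Bool => ((BoolFun.weight a).choose k : K)) ∈ lowDeg K n k := by
  classical
  have : (fun a : Fin n → Bool => ((BoolFun.weight a).choose k : K))
      = ∑ I ∈ powersetCard k univ, monom K I := by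
    funext a
    rw [Finset.sum_apply]
    simp only [monom_apply]
    rw [← sum_filter, sum_const, nsmul_eq_mul, mul_one]
    congr 1
    rw [BoolFun.weight, ← card_powersetCard]
    congr 1
    ext I
    simp only [mem_powersetCard, mem_filter, true_and, subset_iff, mem_univ]
    tauto
  rw [this]
  exact Submodule.sum_mem _ fun I hI => monom_mem (mem_powersetCard.mp hI).2.le

/-- Newton's forward difference formula for a sequence whose differences of order `b` vanish. -/
lemma eq_sum_choose_of_act_eq_zero {s : ℕ → K} {b : ℕ} (h : act ((X - 1) ^ b) s = 0) (i : ℕ) :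
    s i = ∑ k ∈ range b, act ((X - 1) ^ k) s 0 * (i.choose k : K) := by
  have hvan : ∀ k, b ≤ k → act ((X - 1) ^ k) s = 0 := by
    intro k hk
    rw [← Nat.sub_add_cancel hk, pow_add, act_mul, h, act, map_zero]
  have h1 : s i = act (X ^ i) s 0 := by
    rw [act, map_pow, aeval_X, shift_pow_apply, zero_add]
  have h2 : (X : K[X]) ^ i = ∑ k ∈ range (i + 1), (X - 1) ^ k * ((i.choose k : ℕ) : K[X]) := by
    conv_lhs => rw [show (X : K[X]) = (X - 1) + 1 by ring, add_pow]
    simp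
  have h3 : ∀ k, act ((X - 1) ^ k * ((i.choose k : ℕ) : K[X])) s 0
      = act ((X - 1) ^ k) s 0 * (i.choose k : K) := by
    intro k
    rw [mul_comm, ← C_eq_natCast, act_mul, act, aeval_C, mul_comm]
    rfl
  have h4 : s i = ∑ k ∈ range (i + 1), act ((X - 1) ^ k) s 0 * (i.choose k : K) := by
    rw [h1, h2, act, map_sum, LinearMap.sum_apply, Finset.sum_apply]
    exact sum_congr rfl fun k _ => h3 k
  rw [h4]
  rcases le_total b (i + 1) with hb | hb
  · refine (sum_subset (range_mono hb) fun k _ hk => ?_).symm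
    rw [hvan k (by simpa using hk), Pi.zero_apply, zero_mul]
  · refine sum_subset (range_mono hb) fun k _ hk => ?_
    rw [Nat.choose_eq_zero_of_lt (by simpa using hk), Nat.cast_zero, mul_zero]

/-- A symmetric function whose period is a power of the characteristic, or `1`, is a polynomial of
degree at most its period. -/
lemma mem_lowDeg_of_per (hg : g.IsSymmetric)
    (hb : ∀ s : ℕ → K, act ((X - 1) ^ g.per) s = act (X ^ g.per - 1) s) :
    (fun a => bitVal K (g a)) ∈ lowDeg K n g.per := by
  obtain ⟨hpos, hper⟩ := per_spec g
  let s : ℕ → K := fun i => bitVal K (g.spec (i % g.per))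
  have hs : act ((X - 1) ^ g.per) s = 0 := by
    funext j
    rw [hb, act_X_pow_sub_one, Pi.zero_apply, sub_eq_zero]
    simp only [s, Nat.add_mod_right]
  have hspec : ∀ i, i ≤ n → g.spec i = g.spec (i % g.per) := by
    intro i
    induction i using Nat.strong_induction_on with
    | _ i ih =>
    intro hi
    by_cases hlt : i < g.per
    · rw [Nat.mod_eq_of_lt hlt]
    · push Not at hlt
      have h1 := hper (i - g.per) (by omega)
      rw [show i - g.per + g.per = i by omega] at h1
      rw [← h1, ih (i - g.per) (by omega) (by omega), Nat.mod_eq_sub_mod hlt]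
  have hfun : (fun a => bitVal K (g a)) = ∑ k ∈ range g.per, act ((X - 1) ^ k) s 0 •
      fun a : Fin n → Bool => ((BoolFun.weight a).choose k : K) := by
    funext a
    rw [Finset.sum_apply, BoolFun.eq_spec_weight hg, hspec _ (weight_le a)]
    exact eq_sum_choose_of_act_eq_zero hs _
  rw [hfun]
  refine Submodule.sum_mem _ fun k hk => Submodule.smul_mem _ _ ?_
  exact lowDeg_mono (mem_range.mp hk).le (choose_weight_mem_lowDeg k)

lemma mem_lowDeg_of_isPowerOf {p : ℕ} [CharP K p] (hp : p.Prime) (hg : g.IsSymmetric)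
    (h : IsPowerOf p g.per) : (fun a => bitVal K (g a)) ∈ lowDeg K n g.per := by
  have : Fact p.Prime := ⟨hp⟩
  obtain ⟨j, -, hj⟩ := h
  refine mem_lowDeg_of_per hg fun s => ?_
  rw [hj, sub_pow_char_pow, one_pow]

lemma mem_lowDeg_of_per_eq_one (hg : g.IsSymmetric) (h : g.per = 1) :
    (fun a => bitVal K (g a)) ∈ lowDeg K n g.per :=
  mem_lowDeg_of_per hg fun s => by rw [h, pow_one, pow_one]

end PeriodicPolynomials

/-! ### Translation to the probabilistic degree -/

section Assembly

variable {F : Type*} [Field F] {n : ℕ} {ε : ℝ} {f g h : BoolFun n}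

lemma log_add_one_le (hn : 2 ≤ n) : ((Nat.log 2 n + 1 : ℕ) : ℝ) ≤ 3 * Real.log n := by
  have hnR : (0 : ℝ) < n := by positivity
  have h1 : ((2 : ℝ) ^ Nat.log 2 n) ≤ n := by exact_mod_cast Nat.pow_log_le_self 2 (by omega)
  have h2 := Real.log_le_log (by positivity) h1
  rw [Real.log_pow] at h2
  have h3 : Real.log 2 ≤ Real.log n := Real.log_le_log (by norm_num) (by exact_mod_cast hn)
  have h4 := Real.log_two_gt_d9
  have h5 : (0 : ℝ) ≤ Nat.log 2 n := Nat.cast_nonneg _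
  push_cast
  nlinarith

lemma div_log_pow_le (hn : 2 ≤ n) {C X : ℝ} {d : ℕ} (hC : 0 < C)
    (hX : X ≤ C * ((Nat.log 2 n + 1 : ℕ) : ℝ) ^ 3 * d) :
    1 / (27 * C) * X / Real.log n ^ 3 ≤ d := by
  have hlog : 0 < Real.log n := Real.log_pos (by exact_mod_cast (show 1 < n by omega))
  rw [div_le_iff₀ (by positivity), one_div_mul_eq_div, div_le_iff₀ (by positivity)]
  calc X ≤ C * ((Nat.log 2 n + 1 : ℕ) : ℝ) ^ 3 * d := hX
    _ ≤ C * (3 * Real.log n) ^ 3 * d := by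
        have := pow_le_pow_left₀ (Nat.cast_nonneg _) (log_add_one_le hn) 3
        gcongr
    _ = d * Real.log n ^ 3 * (27 * C) := by ring

lemma one_le_pdeg (hε0 : 0 ≤ ε) (hε : ε ≤ 1 / 3) (hf : ¬ f.IsConstant) : 1 ≤ pdeg F ε f := by
  by_contra hlt
  have hp := probApprox_pdeg (K := F) hε0 f
  rw [show pdeg F ε f = 0 by omega] at hp
  exact hf (hp.isConstant hε)

lemma not_isConstant_of_one_lt_per (hs : BoolFun.IsStandardDecomposition f g h)
    (h1 : 1 < g.per) : ¬ f.IsConstant := by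
  intro hc
  have := per_le_of_period hs le_rfl fun j _ _ => hc _ _
  omega

lemma standard_self (hs : BoolFun.IsStandardDecomposition f g h) :
    BoolFun.IsStandardDecomposition g g fun _ => false where
  symm := hs.symm_periodic
  symm_periodic := hs.symm_periodic
  agree := fun _ _ _ => rfl
  per_le := fun f' hf' hag => hs.per_le f' hf' fun i hi0 hi1 =>
    (hag i hi0 hi1).trans (hs.agree i hi0 hi1)
  bounded_eq := fun a => by simp

lemma isSymmetric_bounded (hs : BoolFun.IsStandardDecomposition f g h) : h.IsSymmetric := by
  intro a b hab
  rw [hs.bounded_eq, hs.bounded_eq, hs.symm a b hab, hs.symm_periodic a b hab]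

lemma bounded_middle (hs : BoolFun.IsStandardDecomposition f g h) (i : ℕ) (hi0 : n ≤ 3 * i)
    (hi1 : 3 * i ≤ 2 * n) : h.spec i = false := by
  have h1 : h.spec i = xor (f.spec i) (g.spec i) := hs.bounded_eq _
  rw [h1, hs.agree i hi0 hi1, Bool.xor_self]

lemma not_isConstant_of_bd (hB : 1 ≤ h.bd) : ¬ h.IsConstant := by
  intro hc
  have h0 : h.bd ≤ 0 :=
    Nat.sInf_le (s := {k : ℕ | h.IsBounded k}) ⟨h.spec 0, fun i _ _ => hc _ _⟩
  omega

lemma isConstant_of_per_of_bd (hs : BoolFun.IsStandardDecomposition f g h) (hg : g.per = 1)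
    (hB : h.bd = 0) : f.IsConstant := by
  obtain ⟨v, hv⟩ : h.IsBounded h.bd := by
    refine Nat.sInf_mem (s := {k : ℕ | h.IsBounded k}) ⟨n + 1, false, fun i _ _ => ?_⟩
    omega
  rw [hB] at hv
  have hper := (per_spec g).2
  rw [hg] at hper
  have hg0 : ∀ i, i ≤ n → g.spec i = g.spec 0 := by
    intro i
    induction i with
    | zero => intro _; rfl
    | succ i ih => intro hi; rw [← hper i hi, ih (by omega)]
  have hf : ∀ a, f a = xor v (g.spec 0) := by
    intro a
    have hha := hs.bounded_eq a
    rw [BoolFun.eq_spec_weight (isSymmetric_bounded hs),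
      hv (BoolFun.weight a) (Nat.zero_le _) (weight_le a),
      BoolFun.eq_spec_weight hs.symm_periodic, hg0 (BoolFun.weight a) (weight_le a)] at hha
    rw [hha, Bool.xor_assoc, Bool.xor_self, Bool.xor_false]
  intro a b
  rw [hf a, hf b]

lemma le_pdeg_of_not_isPowerOf {p : ℕ} [CharP F p] (hpp : p.Prime ∨ p = 0)
    (hs : BoolFun.IsStandardDecomposition f g h) (hn : 2 ≤ n) (hε0 : 1 / 2 ^ n ≤ ε)
    (hε : ε ≤ 1 / 3) (h1 : 1 < g.per) (hpow : ¬ IsPowerOf p g.per) :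
    √(n * Real.log (1 / ε))
      ≤ 30000000 * (p + 3 : ℕ) * ((Nat.log 2 n + 1 : ℕ) : ℝ) ^ 3 * pdeg F ε f := by
  have hεpos : 0 < ε := lt_of_lt_of_le (by positivity) hε0
  have hd := one_le_pdeg (F := F) hεpos.le hε (not_isConstant_of_one_lt_per hs h1)
  have key := (probApprox_pdeg hεpos.le f).of_not_isPowerOf hpp hs hd hn hε0 hε h1 hpow
  refine (Real.sqrt_le_sqrt key).trans ?_
  rw [Real.sqrt_sq (by positivity)]
  generalize pdeg F ε f = d
  have hL : (1 : ℝ) ≤ (Nat.log 2 n + 1 : ℕ) := by exact_mod_cast Nat.le_add_left 1 _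
  rw [show 201 * (Nat.log 2 n + 1) * d = (Nat.log 2 n + 1) * (201 * d) by ring]
  generalize Nat.log 2 n + 1 = L at *
  push_cast
  have h2 : (p + 3 : ℝ) * (L : ℝ) ^ 2 * d ≤ (p + 3 : ℝ) * (L : ℝ) ^ 3 * d := by
    gcongr
    · norm_num
  have h3 : 0 ≤ (p + 3 : ℝ) * (L : ℝ) ^ 3 * d := by positivity
  nlinarith

/-- If the period is a power of the characteristic, then the degree of `f` is at least of the order
of `√(n log (1/ε))` or of the period. -/
lemma le_or_le_pdeg_of_isPowerOf {p : ℕ} [CharP F p] (hp : p.Prime)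
    (hs : BoolFun.IsStandardDecomposition f g h) (hn : 2 ≤ n) (hε0 : 1 / 2 ^ n ≤ ε)
    (hε : ε ≤ 1 / 3) (hd : 1 ≤ pdeg F ε f) :
    √(n * Real.log (1 / ε))
        ≤ 30000000 * (p + 3 : ℕ) * ((Nat.log 2 n + 1 : ℕ) : ℝ) ^ 3 * pdeg F ε f ∨
      (g.per : ℝ) ≤ 5628 * (p + 3 : ℕ) * ((Nat.log 2 n + 1 : ℕ) : ℝ) ^ 2 * pdeg F ε f := by
  have hεpos : 0 < ε := lt_of_lt_of_le (by positivity) hε0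
  have key := (probApprox_pdeg hεpos.le f).of_isPowerOf hp hs hd hn hε0 hε
  generalize pdeg F ε f = d at *
  have hL : (1 : ℝ) ≤ (Nat.log 2 n + 1 : ℕ) := by exact_mod_cast Nat.le_add_left 1 _
  have hdR : (1 : ℝ) ≤ d := by exact_mod_cast hd
  rw [show 201 * (Nat.log 2 n + 1) * d = (Nat.log 2 n + 1) * (201 * d) by ring] at key
  generalize Nat.log 2 n + 1 = L at *
  push_cast at key ⊢
  rcases key with key | key
  · left
    refine (Real.sqrt_le_sqrt key).trans ?_
    rw [Real.sqrt_sq (by positivity)]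
    have h2 : (p + 3 : ℝ) * (L : ℝ) ^ 2 * d ≤ (p + 3 : ℝ) * (L : ℝ) ^ 3 * d := by
      gcongr
      · norm_num
    have h3 : 0 ≤ (p + 3 : ℝ) * (L : ℝ) ^ 3 * d := by positivity
    nlinarith
  · right
    have h2 : 1 ≤ (L : ℝ) ^ 2 * d := one_le_mul_of_one_le_of_one_le (one_le_pow₀ hL) hdR
    nlinarith

lemma le_pdeg_of_bounded (hsym : h.IsSymmetric)
    (hmid : ∀ i, n ≤ 3 * i → 3 * i ≤ 2 * n → h.spec i = false) (hB : 1 ≤ h.bd) (p : ℕ)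
    (hn : 2 ≤ n) (hε0 : 1 / 2 ^ n ≤ ε) (hε : ε ≤ 1 / 3) :
    √(h.bd * Real.log (1 / ε)) + Real.log (1 / ε)
      ≤ 30000000 * (p + 3 : ℕ) * ((Nat.log 2 n + 1 : ℕ) : ℝ) ^ 3 * pdeg F ε h := by
  have hεpos : 0 < ε := lt_of_lt_of_le (by positivity) hε0
  have hd := one_le_pdeg (F := F) hεpos.le hε (not_isConstant_of_bd hB)
  refine ((probApprox_pdeg hεpos.le h).of_bounded hsym hmid hB hd hn hε0 hε).trans ?_
  generalize pdeg F ε h = d at *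
  have hL : (1 : ℝ) ≤ (Nat.log 2 n + 1 : ℕ) := by exact_mod_cast Nat.le_add_left 1 _
  generalize Nat.log 2 n + 1 = L at *
  push_cast
  have h2 : (L : ℝ) ^ 1 ≤ (L : ℝ) ^ 3 := pow_le_pow_right₀ hL (by norm_num)
  calc 20 * (201 * (L : ℝ) * d) = 4020 * (L : ℝ) ^ 1 * d := by ring
    _ ≤ 4020 * (L : ℝ) ^ 3 * d := by gcongr
    _ ≤ 30000000 * (p + 3 : ℝ) * (L : ℝ) ^ 3 * d := by
        have : (4020 : ℝ) ≤ 30000000 * (p + 3 : ℝ) := by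
          have : (0 : ℝ) ≤ p := Nat.cast_nonneg p
          linarith
        gcongr

/-- If the periodic part has degree at most its period `b` and `b` is at most of the order of the
probabilistic degree of `f`, then the bounded part has about the same probabilistic degree as
`f`. -/
lemma le_pdeg_of_per_le {p : ℕ} (hs : BoolFun.IsStandardDecomposition f g h)
    (hlow : (fun a => bitVal F (g a)) ∈ lowDeg F n g.per) (hB : 1 ≤ h.bd)
    (hn : 2 ≤ n) (hε0 : 1 / 2 ^ n ≤ ε) (hε : ε ≤ 1 / 3) (hd : 1 ≤ pdeg F ε f)
    (hper : (g.per : ℝ)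
      ≤ 5628 * (p + 3 : ℕ) * ((Nat.log 2 n + 1 : ℕ) : ℝ) ^ 2 * pdeg F ε f) :
    g.per + √(h.bd * Real.log (1 / ε)) + Real.log (1 / ε)
      ≤ 30000000 * (p + 3 : ℕ) * ((Nat.log 2 n + 1 : ℕ) : ℝ) ^ 3 * pdeg F ε f := by
  have hεpos : 0 < ε := lt_of_lt_of_le (by positivity) hε0
  have hh := ((probApprox_pdeg (K := F) hεpos.le f).xor hlow hs.bounded_eq).of_bounded
    (isSymmetric_bounded hs) (bounded_middle hs) hB (by omega) hn hε0 hε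
  generalize pdeg F ε f = d at *
  generalize g.per = b at *
  have hL : (1 : ℝ) ≤ (Nat.log 2 n + 1 : ℕ) := by exact_mod_cast Nat.le_add_left 1 _
  generalize Nat.log 2 n + 1 = L at *
  push_cast at hh hper ⊢
  have hp0 : (0 : ℝ) ≤ p := Nat.cast_nonneg p
  have hd0 : (0 : ℝ) ≤ d := Nat.cast_nonneg d
  have h1 : (L : ℝ) ^ 1 ≤ (L : ℝ) ^ 3 := pow_le_pow_right₀ hL (by norm_num)
  have h2 : (L : ℝ) ^ 2 ≤ (L : ℝ) ^ 3 := pow_le_pow_right₀ hL (by norm_num)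
  have h3 : (L : ℝ) * d ≤ (p + 3 : ℝ) * (L : ℝ) ^ 3 * d := by
    calc (L : ℝ) * d = 1 * (L : ℝ) ^ 1 * d := by ring
      _ ≤ (p + 3 : ℝ) * (L : ℝ) ^ 3 * d := by
        have : (1 : ℝ) ≤ p + 3 := by linarith
        gcongr
  have h4 : (b : ℝ) ≤ 5628 * ((p + 3 : ℝ) * (L : ℝ) ^ 3 * d) := by
    calc (b : ℝ) ≤ 5628 * ((p + 3 : ℝ) * (L : ℝ) ^ 2 * d) := by linarith
      _ ≤ _ := by gcongr
  have h5 : (L : ℝ) * b ≤ 5628 * ((p + 3 : ℝ) * (L : ℝ) ^ 3 * d) := by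
    calc (L : ℝ) * b ≤ L * (5628 * (p + 3) * L ^ 2 * d) := by gcongr
      _ = _ := by ring
  have h6 : 0 ≤ (p + 3 : ℝ) * (L : ℝ) ^ 3 * d := by positivity
  linarith

end Assembly

end ProbDegree

theorem theorem1p3 (p : ℕ) :
    ∃ c : ℝ, 0 < c ∧ ∃ k : ℕ,
      ∀ (F : Type*) [Field F] [CharP F p] (n : ℕ) (f g h : BoolFun n),
        BoolFun.IsStandardDecomposition f g h →
        ∀ ε : ℝ, 1 / 2 ^ n ≤ ε → ε ≤ 1 / 3 →
          -- the periodic part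
          ((1 < g.per ∧ ¬ IsPowerOf p g.per →
              c * √(n * Real.log (1 / ε)) / Real.log n ^ k ≤ pdeg F ε g) ∧
            (IsPowerOf p g.per →
              c * min √(n * Real.log (1 / ε)) g.per / Real.log n ^ k ≤ pdeg F ε g)) ∧
          -- the bounded part
          (1 ≤ h.bd →
              c * (√(h.bd * Real.log (1 / ε)) + Real.log (1 / ε)) / Real.log n ^ k
                ≤ pdeg F ε h) ∧
          -- the function itself
          ((1 < g.per ∧ ¬ IsPowerOf p g.per →
              c * √(n * Real.log (1 / ε)) / Real.log n ^ k ≤ pdeg F ε f) ∧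
            (IsPowerOf p g.per ∧ h.bd = 0 →
              c * min √(n * Real.log (1 / ε)) g.per / Real.log n ^ k ≤ pdeg F ε f) ∧
            (¬ (1 < g.per ∧ ¬ IsPowerOf p g.per) → ¬ (IsPowerOf p g.per ∧ h.bd = 0) →
              ¬ f.IsConstant →
              c * min √(n * Real.log (1 / ε))
                  (g.per + √(h.bd * Real.log (1 / ε)) + Real.log (1 / ε)) / Real.log n ^ k
                ≤ pdeg F ε f)) := by
  refine ⟨1 / (27 * (30000000 * (p + 3 : ℕ))), by positivity, 3, ?_⟩
  intro F _ _ n f g h hs ε hε0 hε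
  have hC : (0 : ℝ) < 30000000 * (p + 3 : ℕ) := by positivity
  have hεpos : 0 < ε := lt_of_lt_of_le (by positivity) hε0
  have hn : 2 ≤ n := by
    by_contra hlt
    have : n = 0 ∨ n = 1 := by omega
    rcases this with rfl | rfl <;> norm_num at hε0 <;> linarith
  have hpp : p.Prime ∨ p = 0 := CharP.char_is_prime_or_zero F p
  have hper0 := (ProbDegree.per_spec g).1
  have hprime : IsPowerOf p g.per → p.Prime ∧ 1 < g.per := by
    rintro ⟨j, hj, hjp⟩
    rcases hpp with hp | rfl
    · exact ⟨hp, by rw [hjp]; exact Nat.one_lt_pow (by omega) hp.one_lt⟩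
    · rw [zero_pow (by omega)] at hjp; omega
  -- the bound by the period is the same for `f` and for `g`
  have hmin : ∀ {f' h' : BoolFun n}, BoolFun.IsStandardDecomposition f' g h' →
      IsPowerOf p g.per → min √(n * Real.log (1 / ε)) g.per
        ≤ 30000000 * (p + 3 : ℕ) * ((Nat.log 2 n + 1 : ℕ) : ℝ) ^ 3 * pdeg F ε f' := by
    intro f' h' hs' hpow
    obtain ⟨hp, h1⟩ := hprime hpow
    have hd := ProbDegree.one_le_pdeg (F := F) hεpos.le hε
      (ProbDegree.not_isConstant_of_one_lt_per hs' h1)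
    rcases ProbDegree.le_or_le_pdeg_of_isPowerOf (F := F) hp hs' hn hε0 hε hd with h2 | h2
    · exact (min_le_left _ _).trans h2
    · refine (min_le_right _ _).trans (h2.trans ?_)
      have hL : (1 : ℝ) ≤ (Nat.log 2 n + 1 : ℕ) := by exact_mod_cast Nat.le_add_left 1 _
      gcongr
      · norm_num
      · norm_num
  refine ⟨⟨fun hg => ?_, fun hg => ?_⟩, fun hB => ?_, fun hg => ?_, fun hg => ?_,
    fun hg1 hg2 hf => ?_⟩ <;> refine ProbDegree.div_log_pow_le hn hC ?_
  · exact ProbDegree.le_pdeg_of_not_isPowerOf hpp (ProbDegree.standard_self hs) hn hε0 hε hg.1 hg.2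
  · exact hmin (ProbDegree.standard_self hs) hg
  · exact ProbDegree.le_pdeg_of_bounded (ProbDegree.isSymmetric_bounded hs)
      (ProbDegree.bounded_middle hs) hB p hn hε0 hε
  · exact ProbDegree.le_pdeg_of_not_isPowerOf hpp hs hn hε0 hε hg.1 hg.2
  · exact hmin hs hg.1
  · have hd := ProbDegree.one_le_pdeg (F := F) hεpos.le hε hf
    have hcase : IsPowerOf p g.per ∨ g.per = 1 := by
      by_contra! hc
      exact hg1 ⟨by omega, hc.1⟩
    have hB : 1 ≤ h.bd := by
      by_contra hlt
      rcases hcase with hpow | hone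
      · exact hg2 ⟨hpow, by omega⟩
      · exact hf (ProbDegree.isConstant_of_per_of_bd hs hone (by omega))
    rcases hcase with hpow | hone
    · obtain ⟨hp, -⟩ := hprime hpow
      rcases ProbDegree.le_or_le_pdeg_of_isPowerOf (F := F) hp hs hn hε0 hε hd with h2 | h2
      · exact (min_le_left _ _).trans h2
      · exact (min_le_right _ _).trans (ProbDegree.le_pdeg_of_per_le hs
          (ProbDegree.mem_lowDeg_of_isPowerOf hp hs.symm_periodic hpow) hB hn hε0 hε hd h2)
    · refine (min_le_right _ _).trans (ProbDegree.le_pdeg_of_per_le hs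
          (ProbDegree.mem_lowDeg_of_per_eq_one hs.symm_periodic hone) hB hn hε0 hε hd ?_)
      have hL : (1 : ℝ) ≤ (Nat.log 2 n + 1 : ℕ) := by exact_mod_cast Nat.le_add_left 1 _
      have hdR : (1 : ℝ) ≤ pdeg F ε f := by exact_mod_cast hd
      have hP : (1 : ℝ) ≤ 5628 * (p + 3 : ℕ) := by
        push_cast
        linarith [Nat.cast_nonneg (α := ℝ) p]
      rw [hone, Nat.cast_one]
      exact one_le_mul_of_one_le_of_one_le
        (one_le_mul_of_one_le_of_one_le hP (one_le_pow₀ hL)) hdR
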